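/- Let $\lambda_1,\dots,\lambda_4$ be pairwise distinct real numbers, $\Lambda=\mathrm{diag}(\lambda_1,\dots,\lambda_4)$, and let $\sigma\in S_4$ be the permutation with $\lambda_{\sigma(1)}>\lambda_{\sigma(2)}>\lambda_{\sigma(3)}>\lambda_{\sigma(4)}$. The full symmetric Toda flow on $SO_4(\mathbb R)$ is given by $\dot\Psi=-A(\Psi)\Psi$, where $A(\Psi)=L_+-L_-$ is the strictly upper triangular part of $L=\Psi\Lambda\Psi^{-1}$ minus its strictly lower triangular part. Let $N$ be the group of diagonal matrices in $SO_4(\mathbb R)$. The flow descends to $Fl_4(\mathbb R)=SO_4(\mathbb R)/N$; trajectories and singular points (zeros of the vector field) are understood there. For $w\in S_4$ let $\tilde s_w\in Fl_4(\mathbb R)$ be the class of the matrices in $SO_4(\mathbb R)$ whose nonzero entries are $\pm1$ at the places $(i,w(i))$. Let $<$ be the strict Bruhat order on $S_4$, generated by the relations $x<y$ for $y=(i\,j)x$, $l(y)=l(x)+1$, where $l$ is the number of inversions. For $x<y$, the segment $[x;y]$ has length $k$ if $k$ is the largest $m$ for which there is a chain $x=x_0<x_1<\dots<x_m=y$. Then: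 1. $w\mapsto\tilde s_w$ is a bijection from $S_4$ onto the set of singular points; in particular there are 24 of them. 2. For all $v,w\in S_4$ there is a non-constant trajectory $\gamma:\mathbb R\to Fl_4(\mathbb R)$ with $\gamma(t)\to\tilde s_{\sigma v}$ as $t\to-\infty$ and $\gamma(t)\to\tilde s_{\sigma w}$ as $t\to+\infty$ if and only if $v<w$. In particular, two distinct singular points $\tilde s_{\sigma v}$, $\tilde s_{\sigma w}$ are connected by a trajectory if and only if $v$ and $w$ are comparable in the Bruhat order. 3. For every integer $k\ge1$ (in particular for $k=2,\dots,6$) and all $v,w\in S_4$, the non-constant trajectories going from $\tilde s_{\sigma v}$ to $\tilde s_{\sigma w}$ form a $k$-dimensional flow, that is, the union of these trajectories is a non-empty embedded smooth $k$-dimensional submanifold of $Fl_4(\mathbb R)$, if and only if $v<w$ and the segment $[v;w]$ has length $k$. -/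

import Mathlib

open scoped ContDiff

namespace Toda

/-- The group `SO_n(ℝ)`. -/
abbrev SO (n : ℕ) : Type := Matrix.specialOrthogonalGroup (Fin n) ℝ

/-- The finite group of diagonal matrices in `SO_n(ℝ)`, that is, the intersection of `SO_n(ℝ)` with
the group of upper triangular matrices. -/
def diagSubgroup (n : ℕ) : Subgroup (SO n) where
  carrier := {g | (g : Matrix (Fin n) (Fin n) ℝ).IsDiag}
  one_mem' := by
    intro i j hij
    exact Matrix.one_apply_ne hij
  mul_mem' := by
    intro a b ha hb i j hij
    show ((a : Matrix (Fin n) (Fin n) ℝ) * (b : Matrix (Fin n) (Fin n) ℝ)) i j = 0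
    rw [Matrix.mul_apply]
    refine Finset.sum_eq_zero fun k _ => ?_
    by_cases hik : i = k
    · subst hik
      rw [hb hij, mul_zero]
    · rw [ha hik, zero_mul]
  inv_mem' := by
    intro a ha i j hij
    exact ha (Ne.symm hij)

/-- The flag manifold `Fl_n(ℝ) = SO_n(ℝ) / (SO_n(ℝ) ∩ B⁺_n)`, with the quotient topology; this is
the phase space of the flow. The projection from `SO_n(ℝ)` is a finite covering. -/
abbrev Flag (n : ℕ) : Type := SO n ⧸ diagSubgroup n

/-- The Lax matrix `L = Ψ Λ Ψ⁻¹`, where `Λ = diag(λ₁, …, λₙ)` and `Ψ⁻¹ = Ψᵀ`. -/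
noncomputable def laxMatrix {n : ℕ} (lam : Fin n → ℝ) (Ψ : Matrix (Fin n) (Fin n) ℝ) :
    Matrix (Fin n) (Fin n) ℝ :=
  Ψ * Matrix.diagonal lam * Ψ.transpose

/-- `A(L) = L₊ - L₋`: the part of `L` above the diagonal minus the part below the diagonal. -/
noncomputable def antisymmetrization {n : ℕ} (L : Matrix (Fin n) (Fin n) ℝ) :
    Matrix (Fin n) (Fin n) ℝ :=
  Matrix.of fun i j => if i < j then L i j else if j < i then -L i j else 0

/-- The vector field `Ψ ↦ -A(Ψ) Ψ` of the full symmetric Toda flow on `SO_n(ℝ)`. -/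
noncomputable def todaField {n : ℕ} (lam : Fin n → ℝ) (Ψ : Matrix (Fin n) (Fin n) ℝ) :
    Matrix (Fin n) (Fin n) ℝ :=
  -(antisymmetrization (laxMatrix lam Ψ) * Ψ)

/-- `Ψ : ℝ → SO_n(ℝ)` solves `dΨ/dt = -A(Ψ) Ψ`. -/
def IsSolution {n : ℕ} (lam : Fin n → ℝ) (Ψ : ℝ → SO n) : Prop :=
  ∀ (t : ℝ) (i j : Fin n),
    HasDerivAt (fun s => (Ψ s : Matrix (Fin n) (Fin n) ℝ) i j)
      (todaField lam (Ψ t : Matrix (Fin n) (Fin n) ℝ) i j) t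

/-- A trajectory of the flow induced on `Fl_n(ℝ)`: the image of a trajectory in `SO_n(ℝ)`. -/
def IsTrajectory {n : ℕ} (lam : Fin n → ℝ) (γ : ℝ → Flag n) : Prop :=
  ∃ Ψ : ℝ → SO n, IsSolution lam Ψ ∧ ∀ t, γ t = (Ψ t : Flag n)

/-- The singular points in `Fl_n(ℝ)`: the classes of the zeros of the vector field. (The zeros form
a union of cosets of the diagonal matrices.) -/
def IsSingularPoint {n : ℕ} (lam : Fin n → ℝ) (p : Flag n) : Prop :=
  ∃ Ψ : SO n, (Ψ : Flag n) = p ∧ todaField lam (Ψ : Matrix (Fin n) (Fin n) ℝ) = 0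

/-- `γ` is a (non-constant) trajectory going from `x` (at `t → -∞`) to `y` (at `t → +∞`). -/
def IsConnecting {n : ℕ} (lam : Fin n → ℝ) (x y : Flag n) (γ : ℝ → Flag n) : Prop :=
  IsTrajectory lam γ ∧ (∃ s t, γ s ≠ γ t) ∧
    Filter.Tendsto γ Filter.atBot (nhds x) ∧ Filter.Tendsto γ Filter.atTop (nhds y)

/-- The space spanned by the trajectories going from `x` to `y`: the union of all of them. -/
def flowSpace {n : ℕ} (lam : Fin n → ℝ) (x y : Flag n) : Set (Flag n) :=
  {p | ∃ γ : ℝ → Flag n, IsConnecting lam x y γ ∧ ∃ t, γ t = p}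

/-- The preimage in `SO_n(ℝ) ⊆ ℝ^{n × n}` of a set of flags. -/
def matrixPreimage {n : ℕ} (W : Set (Flag n)) : Set (Fin n → Fin n → ℝ) :=
  {M | ∃ g : SO n, (g : Flag n) ∈ W ∧ ∀ i j, (g : Matrix (Fin n) (Fin n) ℝ) i j = M i j}

/-- `S` is an embedded smooth submanifold of dimension `k` of the finite-dimensional space `E`:
around each of its points `p` it is the zero set of `dim E - k` smooth functions whose differentials
are linearly independent at `p` (and so near `p`). -/
def IsEmbeddedSubmanifold {E : Type*} [NormedAddCommGroup E] [NormedSpace ℝ E] (k : ℕ)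
    (S : Set E) : Prop :=
  ∀ p ∈ S, ∃ (U : Set E) (m : ℕ) (f : E → (Fin m → ℝ)), IsOpen U ∧ p ∈ U ∧
    m + k = Module.finrank ℝ E ∧ ContDiffOn ℝ ∞ f U ∧
    Function.Surjective (fderiv ℝ f p) ∧ S ∩ U = {q ∈ U | f q = 0}

/-- The trajectories going from `x` to `y` form a `k`-dimensional flow: there are such trajectories
and the space that they span is a submanifold of dimension `k` of `Fl_n(ℝ)`. Since
`SO_n(ℝ) → Fl_n(ℝ)` is a finite covering by local diffeomorphisms, and `SO_n(ℝ)` is a submanifold of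
the space of matrices, this may be read off from the preimage of that space among the matrices. -/
def IsFlowOfDim {n : ℕ} (lam : Fin n → ℝ) (k : ℕ) (x y : Flag n) : Prop :=
  (flowSpace lam x y).Nonempty ∧
    IsEmbeddedSubmanifold k (matrixPreimage (flowSpace lam x y))

/-- A matrix in `SO_n(ℝ)` with entries `±1` at the places `(i, w i)` and `0` elsewhere; the sign in
the first row is chosen so as to make the determinant `1`. -/
noncomputable def signedPermMatrix {n : ℕ} [NeZero n] (w : Equiv.Perm (Fin n)) : SO n :=
  ⟨Matrix.of fun i j =>
      if w i = j then (if i = 0 then ((Equiv.Perm.sign w : ℤ) : ℝ) else 1) else 0, by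
    have hsq : ((Equiv.Perm.sign w : ℤ) : ℝ) * ((Equiv.Perm.sign w : ℤ) : ℝ) = 1 := by
      rcases Int.units_eq_one_or (Equiv.Perm.sign w) with h | h <;> simp [h]
    rw [Matrix.mem_specialOrthogonalGroup_iff]
    constructor
    · rw [Matrix.mem_orthogonalGroup_iff]
      ext i j
      rw [Matrix.mul_apply, Matrix.one_apply, Finset.sum_eq_single (w i)]
      · by_cases hij : i = j
        · subst hij
          by_cases hi : i = 0 <;> simp [hi, hsq]
        · have : w j ≠ w i := fun h => hij (w.injective h).symm
          simp [hij, this]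
      · intro k _ hk
        simp [Ne.symm hk]
      · simp
    · have hM : (Matrix.of fun i j : Fin n =>
          if w i = j then (if i = 0 then ((Equiv.Perm.sign w : ℤ) : ℝ) else 1) else 0) =
          Matrix.diagonal (fun i : Fin n => if i = 0 then ((Equiv.Perm.sign w : ℤ) : ℝ) else 1) *
            w.permMatrix ℝ := by
        ext i j
        rw [Matrix.diagonal_mul]
        by_cases h : w i = j <;> simp [Equiv.toPEquiv_apply, PEquiv.toMatrix_apply, h]
      rw [hM, Matrix.det_mul, Matrix.det_diagonal, Matrix.det_permutation]
      simp [Finset.prod_ite_eq', hsq]⟩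

/-- The point `s̃_w` of `Fl_n(ℝ)`: the class of all matrices in `SO_n(ℝ)` whose nonzero entries
are `±1` at the places `(i, w i)`. There `L = diag(λ_{w(1)}, …, λ_{w(n)})`. -/
noncomputable def permPoint {n : ℕ} [NeZero n] (w : Equiv.Perm (Fin n)) : Flag n :=
  (signedPermMatrix w : Flag n)

/-- The length of a permutation: its number of inversions. -/
def permLength {n : ℕ} (w : Equiv.Perm (Fin n)) : ℕ :=
  (Finset.univ.filter fun p : Fin n × Fin n => p.1 < p.2 ∧ w p.2 < w p.1).card

/-- The generating relations of the Bruhat order: `y = (i, j) x` with `l(y) = l(x) + 1`. -/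
def BruhatStep {n : ℕ} (x y : Equiv.Perm (Fin n)) : Prop :=
  (∃ i j : Fin n, i ≠ j ∧ y = Equiv.swap i j * x) ∧ permLength y = permLength x + 1

/-- The strict Bruhat order on `S_n`. -/
def BruhatLT {n : ℕ} : Equiv.Perm (Fin n) → Equiv.Perm (Fin n) → Prop :=
  Relation.TransGen BruhatStep

/-- The Bruhat segment between `x` and `y` has length `k`: the longest chains
`x = x₀ < x₁ < ⋯ < x_m = y` have `m = k`. -/
def SegmentHasLength {n : ℕ} (x y : Equiv.Perm (Fin n)) (k : ℕ) : Prop :=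
  IsGreatest {m : ℕ | ∃ c : Fin (m + 1) → Equiv.Perm (Fin n),
    c 0 = x ∧ c (Fin.last m) = y ∧ ∀ i : Fin m, BruhatLT (c i.castSucc) (c i.succ)} k

end Toda

namespace Toda

open Matrix Filter Topology InnerProductSpace

/-! The flow is solved by a triangular factorisation. Since `L Ψ = Ψ Λ` and `A + L` is upper
triangular, the matrix `Ψ(t) exp(-tΛ)` is an upper triangular multiple of `Ψ(0)`. Equivalently,
`Ψ(t)` is obtained by orthonormalising the rows of `Ψ(0) exp(-tΛ)`. As `t → +∞` the smallest
eigenvalues dominate these rows, so the limit is read off from the Bruhat cell of `Ψ(0)` for the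
height `-lam`; as `t → -∞` the height is `lam`. Every matrix lies in a cell, so every trajectory has
both limits, and the trajectories between two distinct singular points fill the intersection of two
opposite Bruhat cells (`mem_flowSpace_iff`).

Two questions about such intersections remain. The first is when they are non-empty. A common point
yields, by comparing nonzero terms of minors, the rank inequalities `RankDominated`; conversely a
point is built by induction on the length of `w`, exchanging two adjacent rows
(`exists_inCell_of_rankDominated`). On `S_4` the rank inequalities agree with the Bruhat order, by
finite checks.

The second is the dimension. A cell is cut out locally by minors, one for each inversion or
non-inversion (`inCell_iff_leadDet`), and the equations of the two cells together with orthogonality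
are independent (`exists_fderiv_equations_eq`). Hence the dimension is the difference of the
lengths. It is also the length of the Bruhat segment, because the generating steps raise the length
by one. Uniqueness of the dimension (`IsEmbeddedSubmanifold.dim_unique`) excludes any other `k`. -/

/-! ### Leading minors and Bruhat cells. -/

/-- The leading principal minor of `M` on the rows and columns with index at most `i`. -/
noncomputable def leadDet {n : ℕ} (i : Fin n) (M : Matrix (Fin n) (Fin n) ℝ) : ℝ :=
  (M.toSquareBlockProp (· ≤ i)).det

theorem sum_eq_sum_le {n : ℕ} (i : Fin n) (f : Fin n → ℝ) (hf : ∀ c, i < c → f c = 0) :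
    ∑ c, f c = ∑ c : {a // a ≤ i}, f c := by
  rw [← Finset.sum_subtype (Finset.univ.filter (· ≤ i)) (by simp) f, Finset.sum_filter]
  refine Finset.sum_congr rfl fun c _ => ?_
  split_ifs with hc
  · rfl
  · exact hf c (not_le.1 hc)

/-- The rows up to `i` of `b * M` involve only the rows up to `i` of `M`, so the leading blocks
multiply. Hence the vanishing of minors on first rows is unaffected by invertible lower triangular
changes of rows. -/
theorem leadDet_mul_of_lower {n : ℕ} (i : Fin n) {b : Matrix (Fin n) (Fin n) ℝ}
    (hb : b.IsLowerTriangular) (M : Matrix (Fin n) (Fin n) ℝ) :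
    leadDet i (b * M) = leadDet i b * leadDet i M := by
  unfold leadDet
  rw [← Matrix.det_mul]
  congr 1
  ext ⟨x, hx⟩ ⟨y, hy⟩
  simp only [toSquareBlockProp_def, Matrix.mul_apply, Matrix.of_apply]
  exact sum_eq_sum_le i _ fun c hc => by rw [hb (show x < c from lt_of_le_of_lt hx hc), zero_mul]

theorem leadDet_of_lower {n : ℕ} (i : Fin n) {b : Matrix (Fin n) (Fin n) ℝ}
    (hb : b.IsLowerTriangular) : leadDet i b = ∏ a : {a // a ≤ i}, b a a := by
  unfold leadDet
  rw [Matrix.det_of_isLowerTriangular]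
  · rfl
  · intro x y hxy
    exact hb hxy

theorem leadDet_of_upper {n : ℕ} (i : Fin n) {b : Matrix (Fin n) (Fin n) ℝ}
    (hb : ∀ x y, y < x → x ≤ i → y ≤ i → b x y = 0) :
    leadDet i b = ∏ a : {a // a ≤ i}, b a a := by
  unfold leadDet
  rw [Matrix.det_of_isUpperTriangular]
  · rfl
  · intro x y hxy
    exact hb x y hxy x.2 y.2

theorem diag_ne_zero_of_lower {n : ℕ} {b : Matrix (Fin n) (Fin n) ℝ}
    (hb : b.IsLowerTriangular) (hd : b.det ≠ 0) (i : Fin n) : b i i ≠ 0 := by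
  rw [Matrix.det_of_isLowerTriangular _ hb] at hd
  exact Finset.prod_ne_zero_iff.1 hd i (Finset.mem_univ i)

theorem leadDet_ne_zero_of_lower {n : ℕ} (i : Fin n) {b : Matrix (Fin n) (Fin n) ℝ}
    (hb : b.IsLowerTriangular) (hd : b.det ≠ 0) : leadDet i b ≠ 0 := by
  rw [leadDet_of_lower i hb]
  exact Finset.prod_ne_zero_iff.2 fun a _ => diag_ne_zero_of_lower hb hd a

theorem submatrix_mul_left {n : ℕ} (b g : Matrix (Fin n) (Fin n) ℝ) (w : Equiv.Perm (Fin n)) :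
    (b * g).submatrix id w = b * g.submatrix id w := by
  ext i j
  simp [Matrix.mul_apply]

/-- A matrix with nonvanishing leading principal minors becomes upper unitriangular after a left
multiplication by an invertible lower triangular matrix. -/
theorem exists_lower_mul_eq_upper {n : ℕ} (M : Matrix (Fin n) (Fin n) ℝ)
    (hM : ∀ i, leadDet i M ≠ 0) :
    ∃ b : Matrix (Fin n) (Fin n) ℝ, b.IsLowerTriangular ∧ b.det ≠ 0 ∧
      (∀ i j, j < i → (b * M) i j = 0) ∧ ∀ i, (b * M) i i = 1 := by
  -- Row `i` of `b` is the last row of the inverse of the leading block up to `i`, so `b * M` agrees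
  -- with the identity on and below the diagonal.
  let b : Matrix (Fin n) (Fin n) ℝ := Matrix.of fun i j =>
    if h : j ≤ i then (M.toSquareBlockProp (· ≤ i))⁻¹ ⟨i, le_rfl⟩ ⟨j, h⟩ else 0
  have hb : b.IsLowerTriangular := by
    intro i j hij
    have : ¬ j ≤ i := not_le.2 hij
    simp [b, this]
  have key : ∀ i j, j ≤ i → (b * M) i j = (1 : Matrix (Fin n) (Fin n) ℝ) i j := by
    intro i j hj
    have hu : IsUnit (M.toSquareBlockProp (· ≤ i)).det := (hM i).isUnit
    have h1 := congrFun (congrFun (Matrix.nonsing_inv_mul _ hu) ⟨i, le_rfl⟩) ⟨j, hj⟩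
    rw [Matrix.mul_apply] at h1 ⊢
    have h2 : (1 : Matrix {a // a ≤ i} {a // a ≤ i} ℝ) ⟨i, le_rfl⟩ ⟨j, hj⟩ =
        (1 : Matrix (Fin n) (Fin n) ℝ) i j := by
      simp [Matrix.one_apply]
    rw [← h2, ← h1]
    rw [sum_eq_sum_le i _ fun c hc => by rw [hb hc, zero_mul]]
    refine Finset.sum_congr rfl fun c _ => ?_
    have hc : (c : Fin n) ≤ i := c.2
    simp [b, hc, toSquareBlockProp_def]
  have hup : ∀ i j, j < i → (b * M) i j = 0 := by
    intro i j hij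
    rw [key i j hij.le, Matrix.one_apply_ne hij.ne']
  have hone : ∀ i, (b * M) i i = 1 := fun i => by rw [key i i le_rfl, Matrix.one_apply_eq]
  refine ⟨b, hb, ?_, hup, hone⟩
  have hdet : (b * M).det = 1 := by
    rw [Matrix.det_of_isUpperTriangular (fun i j h => hup i j h)]
    simp [hone]
  rw [Matrix.det_mul] at hdet
  exact left_ne_zero_of_mul (by rw [hdet]; exact one_ne_zero)

/-- In row `k` of `X` the entries in the columns higher than `w k` vanish. -/
def VanishAbove {n : ℕ} (h : Fin n → ℝ) (w : Equiv.Perm (Fin n))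
    (X : Matrix (Fin n) (Fin n) ℝ) : Prop :=
  ∀ k c, h (w k) < h c → X k c = 0

/-- `g` lies in the Bruhat cell of `w`: up to a lower triangular change of its rows, the highest
nonzero entry of each row `k` is in the column `w k`. -/
def InCell {n : ℕ} (h : Fin n → ℝ) (w : Equiv.Perm (Fin n)) (g : Matrix (Fin n) (Fin n) ℝ) :
    Prop :=
  ∃ b : Matrix (Fin n) (Fin n) ℝ, b.IsLowerTriangular ∧ b.det ≠ 0 ∧
    VanishAbove h w (b * g) ∧ ∀ k, (b * g) k (w k) ≠ 0

/-- A nonzero determinant has a nonzero term in its Leibniz expansion; the permutation of that term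
is `π`. -/
theorem exists_perm_of_leadDet_ne_zero {n : ℕ} {h : Fin n → ℝ} {w : Equiv.Perm (Fin n)}
    {X : Matrix (Fin n) (Fin n) ℝ} (hX : VanishAbove h w X) (u : Equiv.Perm (Fin n)) (i : Fin n)
    (hi : leadDet i (X.submatrix id u) ≠ 0) :
    ∃ π : Equiv.Perm {a // a ≤ i}, ∀ a : {a // a ≤ i}, h (u a) ≤ h (w (π a)) := by
  unfold leadDet at hi
  rw [Matrix.det_apply] at hi
  obtain ⟨π, -, hπ⟩ := Finset.exists_ne_zero_of_sum_ne_zero hi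
  refine ⟨π, fun a => ?_⟩
  by_contra hlt
  apply hπ
  rw [Finset.prod_eq_zero (Finset.mem_univ a), smul_zero]
  simp only [toSquareBlockProp_def, Matrix.of_apply, Matrix.submatrix_apply, id]
  exact hX _ _ (not_le.1 hlt)

/-- In a nonzero term `π` no height `h (w a)` exceeds `h (w (π a))`. Both families have the same
sum, so they agree, and injectivity leaves only the identity. -/
theorem leadDet_eq_prod {n : ℕ} {h : Fin n → ℝ} (hinj : Function.Injective h)
    {w : Equiv.Perm (Fin n)} {X : Matrix (Fin n) (Fin n) ℝ} (hX : VanishAbove h w X) (i : Fin n) :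
    leadDet i (X.submatrix id w) = ∏ a : {a // a ≤ i}, X a (w a) := by
  unfold leadDet
  rw [Matrix.det_apply, Finset.sum_eq_single 1]
  · simp [toSquareBlockProp_def]
  · intro π _ hπ
    by_contra hne
    apply hπ
    have hle : ∀ a : {a // a ≤ i}, h (w a) ≤ h (w (π a)) := by
      intro a
      by_contra hlt
      apply hne
      rw [Finset.prod_eq_zero (Finset.mem_univ a), smul_zero]
      simp only [toSquareBlockProp_def, Matrix.of_apply, Matrix.submatrix_apply, id]
      exact hX _ _ (not_le.1 hlt)
    have hsum : ∑ a : {a // a ≤ i}, h (w a) = ∑ a : {a // a ≤ i}, h (w (π a)) :=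
      (Equiv.sum_comp π (fun a : {a // a ≤ i} => h (w a))).symm
    have heq := (Finset.sum_eq_sum_iff_of_le fun a _ => hle a).1 hsum
    ext a
    have h1 := w.injective (hinj (heq a (Finset.mem_univ a)))
    simp [← h1]
  · simp

/-- The exchange strictly raises the total height of the chosen columns, while a nonzero Leibniz
term would bound it by the total height of the columns `w a`, `a ≤ i`. -/
theorem leadDet_swap_eq_zero {n : ℕ} {h : Fin n → ℝ}
    {w : Equiv.Perm (Fin n)} {X : Matrix (Fin n) (Fin n) ℝ} (hX : VanishAbove h w X) {i j : Fin n}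
    (hij : i < j) (hlt : h (w i) < h (w j)) :
    leadDet i (X.submatrix id (w * Equiv.swap i j : Equiv.Perm (Fin n))) = 0 := by
  by_contra hne
  obtain ⟨π, hπ⟩ := exists_perm_of_leadDet_ne_zero hX (w * Equiv.swap i j) i hne
  have h1 : ∑ a : {a // a ≤ i}, h ((w * Equiv.swap i j) a) ≤ ∑ a : {a // a ≤ i}, h (w a) :=
    (Finset.sum_le_sum fun a _ => hπ a).trans_eq
      (Equiv.sum_comp π (fun a : {a // a ≤ i} => h (w a)))
  refine absurd h1 (not_le.2 (Finset.sum_lt_sum (fun a _ => ?_)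
    ⟨⟨i, le_rfl⟩, Finset.mem_univ _, ?_⟩))
  · rcases eq_or_ne (a : Fin n) i with ha | ha
    · simp [ha, hlt.le]
    · have haj : (a : Fin n) ≠ j := (lt_of_le_of_lt a.2 hij).ne
      simp [Equiv.swap_apply_of_ne_of_ne ha haj]
  · simpa using hlt

/-- This presents a cell by open conditions and by one equation for each admissible pair. For the
converse, normalise `g.submatrix id w` to be upper unitriangular: the exchanged minor of `(k, j)`
then equals the entry `(k, j)`, so each equation kills exactly one entry. -/
theorem inCell_iff_leadDet {n : ℕ} {h : Fin n → ℝ} (hinj : Function.Injective h)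
    (w : Equiv.Perm (Fin n)) (g : Matrix (Fin n) (Fin n) ℝ) :
    InCell h w g ↔ (∀ i, leadDet i (g.submatrix id w) ≠ 0) ∧
      ∀ i j, i < j → h (w i) < h (w j) →
        leadDet i (g.submatrix id (w * Equiv.swap i j : Equiv.Perm (Fin n))) = 0 := by
  constructor
  · rintro ⟨b, hb, hd, hv, hne⟩
    constructor
    · intro i
      have h1 := leadDet_mul_of_lower i hb (g.submatrix id w)
      rw [← submatrix_mul_left, leadDet_eq_prod hinj hv] at h1
      refine right_ne_zero_of_mul (a := leadDet i b) ?_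
      rw [← h1]
      exact Finset.prod_ne_zero_iff.2 fun a _ => hne a
    · intro i j hij hlt
      have h1 := leadDet_mul_of_lower i hb
          (g.submatrix id (w * Equiv.swap i j : Equiv.Perm (Fin n)))
      rw [← submatrix_mul_left, leadDet_swap_eq_zero hv hij hlt] at h1
      exact (mul_eq_zero.1 h1.symm).resolve_left (leadDet_ne_zero_of_lower i hb hd)
  · rintro ⟨hne, hz⟩
    obtain ⟨b, hb, hd, hup, hone⟩ := exists_lower_mul_eq_upper _ hne
    refine ⟨b, hb, hd, ?_, ?_⟩
    · intro k c hc
      obtain ⟨j, rfl⟩ := w.surjective c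
      have hkj : k ≠ j := by rintro rfl; exact lt_irrefl _ hc
      have e : (b * g) k (w j) = (b * g.submatrix id w) k j := by
        rw [← submatrix_mul_left]; rfl
      rw [e]
      rcases lt_or_gt_of_ne hkj with hlt | hlt
      · have h1 := leadDet_mul_of_lower k hb
          (g.submatrix id (w * Equiv.swap k j : Equiv.Perm (Fin n)))
        rw [hz k j hlt hc, mul_zero] at h1
        have h2 : (b * g.submatrix id (w * Equiv.swap k j : Equiv.Perm (Fin n))) =
            (b * g.submatrix id w).submatrix id (Equiv.swap k j) := by
          rw [submatrix_mul_left]; rfl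
        rw [h2, leadDet_of_upper] at h1
        · obtain ⟨a, -, ha⟩ := Finset.prod_eq_zero_iff.1 h1
          rcases eq_or_ne (a : Fin n) k with hak | hak
          · simpa [hak] using ha
          · have haj : (a : Fin n) ≠ j := (lt_of_le_of_lt a.2 hlt).ne
            rw [Matrix.submatrix_apply, Equiv.swap_apply_of_ne_of_ne hak haj, id, hone] at ha
            exact absurd ha one_ne_zero
        · intro x y hyx hx hy
          have hyk : y ≠ k := (lt_of_lt_of_le hyx hx).ne
          have hyj : y ≠ j := (lt_of_le_of_lt hy hlt).ne
          rw [Matrix.submatrix_apply, Equiv.swap_apply_of_ne_of_ne hyk hyj]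
          exact hup x y hyx
      · exact hup k j hlt
    · intro k
      have e : (b * g) k (w k) = (b * g.submatrix id w) k k := by
        rw [← submatrix_mul_left]; rfl
      rw [e, hone]
      exact one_ne_zero

/-- Multiplication on the right by a diagonal matrix preserves the cells. -/
theorem InCell.mul_diagonal {n : ℕ} {h : Fin n → ℝ} {w : Equiv.Perm (Fin n)}
    {g : Matrix (Fin n) (Fin n) ℝ} (hg : InCell h w g) (d : Fin n → ℝ) (hd : ∀ i, d i ≠ 0) :
    InCell h w (g * Matrix.diagonal d) := by
  obtain ⟨b, hb, hdet, hv, hne⟩ := hg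
  refine ⟨b, hb, hdet, ?_, ?_⟩
  · intro k c hc
    rw [← mul_assoc, Matrix.mul_diagonal, hv k c hc, zero_mul]
  · intro k
    rw [← mul_assoc, Matrix.mul_diagonal]
    exact mul_ne_zero (hne k) (hd _)

/-- Bruhat decomposition: each invertible matrix lies in a cell. -/
theorem exists_inCell {n : ℕ} {h : Fin n → ℝ} (hinj : Function.Injective h)
    (g : Matrix (Fin n) (Fin n) ℝ) (hg : g.det ≠ 0) : ∃ w : Equiv.Perm (Fin n), InCell h w g := by
  classical
  -- Coefficients of row `k` plus a combination of earlier rows. Among these the elimination picks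
  -- one whose highest nonzero column is lowest.
  let R : Fin n → Set (Fin n → ℝ) := fun k => {r | r k = 1 ∧ ∀ j, k < j → r j = 0}
  have hrow : ∀ k, ∀ r ∈ R k, ∃ c, (r ᵥ* g) c ≠ 0 := by
    intro k r hr
    by_contra! hc
    have : r ᵥ* g = 0 := funext hc
    have := Matrix.eq_zero_of_vecMul_eq_zero hg this
    have h1 := hr.1
    rw [this] at h1
    exact zero_ne_one h1
  have htop : ∀ k, ∀ r ∈ R k, ∃ c, (r ᵥ* g) c ≠ 0 ∧ ∀ d, h c < h d → (r ᵥ* g) d = 0 := by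
    intro k r hr
    obtain ⟨c, hc⟩ := hrow k r hr
    obtain ⟨c, hc, hmax⟩ := Finset.exists_max_image (Finset.univ.filter fun c => (r ᵥ* g) c ≠ 0) h
      ⟨c, by simpa using hc⟩
    refine ⟨c, by simpa using hc, fun d hd => ?_⟩
    by_contra hne
    exact absurd (hmax d (by simpa using hne)) (not_le.2 hd)
  have hmin : ∀ k, ∃ r ∈ R k, ∃ c, ((r ᵥ* g) c ≠ 0 ∧ ∀ d, h c < h d → (r ᵥ* g) d = 0) ∧
      ∀ r' ∈ R k, ∃ d, h c ≤ h d ∧ (r' ᵥ* g) d ≠ 0 := by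
    intro k
    have hne : (Finset.univ.filter fun c => ∃ r ∈ R k, (r ᵥ* g) c ≠ 0 ∧
        ∀ d, h c < h d → (r ᵥ* g) d = 0).Nonempty := by
      obtain ⟨c, hc⟩ := htop k (Pi.single k 1)
        ⟨by simp, fun j hj => by simp [hj.ne']⟩
      exact ⟨c, by simpa using ⟨_, ⟨by simp, fun j hj => by simp [hj.ne']⟩, hc⟩⟩
    obtain ⟨c, hc, hcmin⟩ := Finset.exists_min_image _ h hne
    obtain ⟨r, hr, hrc⟩ := (Finset.mem_filter.1 hc).2
    refine ⟨r, hr, c, hrc, fun r' hr' => ?_⟩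
    obtain ⟨d, hd⟩ := htop k r' hr'
    exact ⟨d, hcmin d (by simpa using ⟨r', hr', hd⟩), hd.1⟩
  choose r hr w hw hwmin using hmin
  have hwinj : Function.Injective w := by
    have hlt : ∀ j k, j < k → w j ≠ w k := by
      intro j k hjk hjw
      -- If two pivots coincided, subtracting this multiple of the earlier row would cancel the
      -- common top entry, against the minimality of the pivot of row `k`.
      set a := (r k ᵥ* g) (w k) / (r j ᵥ* g) (w j) with ha
      have hr' : r k - a • r j ∈ R k := by
        constructor
        · simp [(hr k).1, (hr j).2 k hjk]
        · intro l hl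
          simp [(hr k).2 l hl, (hr j).2 l (hjk.trans hl)]
      obtain ⟨d, hd, hne⟩ := hwmin k _ hr'
      apply hne
      rw [Matrix.sub_vecMul, Matrix.smul_vecMul]
      simp only [Pi.sub_apply, Pi.smul_apply, smul_eq_mul]
      rcases hd.lt_or_eq with hd | hd
      · rw [(hw k).2 d hd, (hw j).2 d (hjw ▸ hd)]
        simp
      · rw [← hinj hd, ← hjw, ha, ← hjw, div_mul_cancel₀ _ (hw j).1, sub_self]
    intro j k hjk
    by_contra hne
    rcases lt_or_gt_of_ne hne with hl | hl
    · exact hlt _ _ hl hjk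
    · exact hlt _ _ hl hjk.symm
  have hb : (Matrix.of r).IsLowerTriangular := fun i j hij => (hr i).2 j hij
  refine ⟨Equiv.ofBijective w (Finite.injective_iff_bijective.1 hwinj), Matrix.of r, hb, ?_, ?_, ?_⟩
  · rw [Matrix.det_of_isLowerTriangular _ hb]
    simp [(hr _).1]
  · intro k c hc
    exact (hw k).2 c hc
  · intro k
    exact (hw k).1

/-- A matrix lying in the cells of `w` for two opposite height functions is, up to a lower
triangular change of its rows, the permutation matrix of `w`. -/
theorem InCell.exists_lower_mul_eq_one {n : ℕ} {h : Fin n → ℝ} (hinj : Function.Injective h)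
    {w : Equiv.Perm (Fin n)} {g : Matrix (Fin n) (Fin n) ℝ} (h₁ : InCell h w g)
    (h₂ : InCell (-h) w g) :
    ∃ b : Matrix (Fin n) (Fin n) ℝ, b.IsLowerTriangular ∧ b * g.submatrix id w = 1 := by
  have hne := ((inCell_iff_leadDet hinj w g).1 h₁).1
  have hinj' : Function.Injective (-h) := fun a b hab => hinj (neg_injective hab)
  obtain ⟨b, hb, hd, hup, hone⟩ := exists_lower_mul_eq_upper _ hne
  refine ⟨b, hb, ?_⟩
  ext i j
  rcases lt_trichotomy i j with hlt | rfl | hlt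
  · have hz : leadDet i (g.submatrix id (w * Equiv.swap i j : Equiv.Perm (Fin n))) = 0 := by
      -- Whichever of the two columns is higher, one of the two opposite cells makes the exchanged
      -- minor vanish.
      have hwne : h (w i) ≠ h (w j) := fun he => hlt.ne (w.injective (hinj he))
      rcases lt_or_gt_of_ne hwne with hl | hl
      · exact ((inCell_iff_leadDet hinj w g).1 h₁).2 i j hlt hl
      · exact ((inCell_iff_leadDet hinj' w g).1 h₂).2 i j hlt (neg_lt_neg hl)
    have h1 := leadDet_mul_of_lower i hb
          (g.submatrix id (w * Equiv.swap i j : Equiv.Perm (Fin n)))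
    rw [hz, mul_zero] at h1
    have h2 : (b * g.submatrix id (w * Equiv.swap i j : Equiv.Perm (Fin n))) =
        (b * g.submatrix id w).submatrix id (Equiv.swap i j) := by
      rw [submatrix_mul_left]; rfl
    rw [h2, leadDet_of_upper] at h1
    · obtain ⟨a, -, ha⟩ := Finset.prod_eq_zero_iff.1 h1
      rcases eq_or_ne (a : Fin n) i with hai | hai
      · simpa [hai, Matrix.one_apply_ne hlt.ne] using ha
      · have haj : (a : Fin n) ≠ j := (lt_of_le_of_lt a.2 hlt).ne
        rw [Matrix.submatrix_apply, Equiv.swap_apply_of_ne_of_ne hai haj, id, hone] at ha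
        exact absurd ha one_ne_zero
    · intro x y hyx hx hy
      rw [Matrix.submatrix_apply, Equiv.swap_apply_of_ne_of_ne (lt_of_lt_of_le hyx hx).ne
        (lt_of_le_of_lt hy hlt).ne]
      exact hup x y hyx
  · rw [hone, Matrix.one_apply_eq]
  · rw [hup i j hlt, Matrix.one_apply_ne hlt.ne']

/-! ### Points and limits in the flag manifold. -/

theorem SO.mul_transpose {n : ℕ} (g : SO n) :
    (g : Matrix (Fin n) (Fin n) ℝ) * (g : Matrix (Fin n) (Fin n) ℝ)ᵀ = 1 :=
  (Matrix.mem_orthogonalGroup_iff _ _).1 (Matrix.mem_specialOrthogonalGroup_iff.1 g.2).1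

theorem SO.transpose_mul {n : ℕ} (g : SO n) :
    (g : Matrix (Fin n) (Fin n) ℝ)ᵀ * (g : Matrix (Fin n) (Fin n) ℝ) = 1 :=
  (Matrix.mem_orthogonalGroup_iff' _ _).1 (Matrix.mem_specialOrthogonalGroup_iff.1 g.2).1

theorem SO.det {n : ℕ} (g : SO n) : (g : Matrix (Fin n) (Fin n) ℝ).det = 1 :=
  (Matrix.mem_specialOrthogonalGroup_iff.1 g.2).2

theorem SO.sum_row_sq {n : ℕ} (g : SO n) (i : Fin n) : ∑ j, g.1 i j ^ 2 = 1 := by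
  have h := congrFun (congrFun (SO.mul_transpose g) i) i
  rw [Matrix.mul_apply, Matrix.one_apply_eq] at h
  rw [← h]
  exact Finset.sum_congr rfl fun j _ => by rw [Matrix.transpose_apply, sq]

theorem SO.sum_col_sq {n : ℕ} (g : SO n) (j : Fin n) : ∑ i, g.1 i j ^ 2 = 1 := by
  have h := congrFun (congrFun (SO.transpose_mul g) j) j
  rw [Matrix.mul_apply, Matrix.one_apply_eq] at h
  rw [← h]
  exact Finset.sum_congr rfl fun j _ => by rw [Matrix.transpose_apply, sq]

theorem SO.sq_le_one {n : ℕ} (g : SO n) (i j : Fin n) : g.1 i j ^ 2 ≤ 1 := by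
  rw [← SO.sum_row_sq g i]
  exact Finset.single_le_sum (f := fun j => g.1 i j ^ 2) (fun _ _ => sq_nonneg _)
    (Finset.mem_univ j)

theorem flag_eq_iff {n : ℕ} (g g' : SO n) : (g : Flag n) = (g' : Flag n) ↔
    ∃ d : Fin n → ℝ, (∀ i, d i ^ 2 = 1) ∧ g'.1 = g.1 * Matrix.diagonal d := by
  rw [QuotientGroup.eq]
  constructor
  · intro h
    have hdiag : ((g⁻¹ * g' : SO n) : Matrix (Fin n) (Fin n) ℝ).IsDiag := h
    have hm : (g⁻¹ * g' : SO n).1 = g.1ᵀ * g'.1 := rfl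
    refine ⟨Matrix.diag (g⁻¹ * g' : SO n).1, fun i => ?_, ?_⟩
    · have h1 := SO.sum_row_sq (g⁻¹ * g') i
      rwa [Finset.sum_eq_single i] at h1
      · intro j _ hj
        rw [hdiag hj.symm]; simp
      · simp
    · rw [hdiag.diagonal_diag, hm, ← mul_assoc, SO.mul_transpose, one_mul]
  · rintro ⟨d, -, hd⟩
    change (g.1ᵀ * g'.1).IsDiag
    rw [hd, ← mul_assoc, SO.transpose_mul, one_mul]
    exact Matrix.isDiag_diagonal d

theorem signedPermMatrix_apply {n : ℕ} [NeZero n] (w : Equiv.Perm (Fin n)) (i j : Fin n) :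
    (signedPermMatrix w).1 i j =
      if w i = j then (if i = 0 then ((Equiv.Perm.sign w : ℤ) : ℝ) else 1) else 0 := rfl

theorem signedPermMatrix_sq {n : ℕ} [NeZero n] (w : Equiv.Perm (Fin n)) (i : Fin n) :
    (signedPermMatrix w).1 i (w i) ^ 2 = 1 := by
  rw [signedPermMatrix_apply]
  rcases Int.units_eq_one_or (Equiv.Perm.sign w) with h | h <;> simp [h]

/-- A row of norm one with an entry of square one has no other nonzero entry, so `g` differs from
`signedPermMatrix w` only by signs of columns. -/
theorem coe_eq_permPoint_iff {n : ℕ} [NeZero n] (g : SO n) (w : Equiv.Perm (Fin n)) :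
    (g : Flag n) = permPoint w ↔ ∀ i, g.1 i (w i) ^ 2 = 1 := by
  constructor
  · intro h i
    obtain ⟨d, hd, hg⟩ := (flag_eq_iff (signedPermMatrix w) g).1 h.symm
    rw [hg, Matrix.mul_diagonal, mul_pow, hd, mul_one, signedPermMatrix_sq]
  · intro h
    have hz : ∀ i j, w i ≠ j → g.1 i j = 0 := by
      intro i j hij
      have h1 := SO.sum_row_sq g i
      rw [← Finset.add_sum_erase _ _ (Finset.mem_univ (w i)), h i, add_eq_left,
        Finset.sum_eq_zero_iff_of_nonneg fun _ _ => sq_nonneg _] at h1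
      exact pow_eq_zero_iff two_ne_zero |>.1 (h1 j (by simp [hij.symm]))
    refine ((flag_eq_iff (signedPermMatrix w) g).2
      ⟨fun j => (signedPermMatrix w).1 (w.symm j) j * g.1 (w.symm j) j, fun j => ?_, ?_⟩).symm
    · obtain ⟨i, rfl⟩ := w.surjective j
      beta_reduce
      rw [Equiv.symm_apply_apply, mul_pow, signedPermMatrix_sq, h, one_mul]
    · ext i j
      rw [Matrix.mul_diagonal]
      by_cases hij : w i = j
      · subst hij
        rw [Equiv.symm_apply_apply, ← mul_assoc, ← sq, signedPermMatrix_sq, one_mul]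
      · rw [hz i j hij, signedPermMatrix_apply, if_neg hij, zero_mul]

theorem permPoint_injective {n : ℕ} [NeZero n] : Function.Injective (permPoint (n := n)) := by
  intro v w hvw
  have h := (coe_eq_permPoint_iff (signedPermMatrix v) w).1 hvw
  ext i
  by_contra hne
  have h1 := h i
  rw [signedPermMatrix_apply, if_neg fun he => hne (congrArg Fin.val he)] at h1
  norm_num at h1

/-- The square of a matrix entry, as a function on the flag manifold. -/
noncomputable def sqEntry {n : ℕ} (i j : Fin n) : Flag n → ℝ :=
  Quotient.lift (fun g : SO n => g.1 i j ^ 2) fun g g' h => by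
    obtain ⟨d, hd, hg⟩ := (flag_eq_iff g g').1 (Quotient.sound h)
    simp only [hg, Matrix.mul_diagonal, mul_pow, hd, mul_one]

theorem continuous_entry {n : ℕ} (i j : Fin n) : Continuous fun g : SO n => g.1 i j :=
  (continuous_apply j).comp ((continuous_apply i).comp continuous_subtype_val)

theorem continuous_sqEntry {n : ℕ} (i j : Fin n) : Continuous (sqEntry (n := n) i j) :=
  Continuous.quotient_lift ((continuous_entry i j).pow 2) _

theorem compactSpace_SO (n : ℕ) : CompactSpace (SO n) := by
  suffices h : IsCompact (Matrix.specialOrthogonalGroup (Fin n) ℝ :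
      Set (Matrix (Fin n) (Fin n) ℝ)) from isCompact_iff_compactSpace.1 h
  have hc : IsCompact (Set.univ.pi fun _ : Fin n => Set.univ.pi fun _ : Fin n =>
      Set.Icc (-1 : ℝ) 1) :=
    isCompact_univ_pi fun _ => isCompact_univ_pi fun _ => isCompact_Icc
  refine hc.of_isClosed_subset ?_ ?_
  · have : ((Matrix.specialOrthogonalGroup (Fin n) ℝ : Submonoid (Matrix (Fin n) (Fin n) ℝ)) :
        Set (Matrix (Fin n) (Fin n) ℝ)) = {A | A * Aᵀ = 1} ∩ {A | A.det = 1} := by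
      ext A
      exact Matrix.mem_specialOrthogonalGroup_iff.trans
        (and_congr (Matrix.mem_orthogonalGroup_iff _ _) Iff.rfl)
    rw [this]
    exact (isClosed_eq (by fun_prop) continuous_const).inter
      (isClosed_eq (by fun_prop) continuous_const)
  · intro A hA i _ j _
    exact abs_le.1 (sq_le_one_iff_abs_le_one _ |>.1 (SO.sq_le_one ⟨A, hA⟩ i j))

/-- For the converse, the sum `F` of the squares is at most `n`, with equality only over `permPoint
w`. By compactness its maximum off a neighbourhood of that point is less than `n`. -/
theorem tendsto_permPoint_iff {n : ℕ} [NeZero n] {l : Filter ℝ} (Ψ : ℝ → SO n)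
    (w : Equiv.Perm (Fin n)) :
    Tendsto (fun t => (Ψ t : Flag n)) l (𝓝 (permPoint w)) ↔
      ∀ i, Tendsto (fun t => (Ψ t).1 i (w i) ^ 2) l (𝓝 1) := by
  constructor
  · intro h i
    have h1 := ((continuous_sqEntry i (w i)).tendsto (permPoint w)).comp h
    have h2 : sqEntry i (w i) (permPoint w) = 1 := signedPermMatrix_sq w i
    rwa [h2] at h1
  · intro h
    rw [tendsto_nhds]
    intro U hU hw
    have := compactSpace_SO n
    let V : Set (SO n) := (fun g : SO n => (g : Flag n)) ⁻¹' U
    have hV : IsOpen V := hU.preimage continuous_quot_mk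
    let F : SO n → ℝ := fun g => ∑ i, g.1 i (w i) ^ 2
    have hF : Continuous F := continuous_finsetSum _ fun i _ => (continuous_entry i (w i)).pow 2
    have hle : ∀ g, F g ≤ n := fun g => by
      refine (Finset.sum_le_sum fun i _ => SO.sq_le_one g i (w i)).trans_eq ?_
      simp
    have hlim : Tendsto (fun t => F (Ψ t)) l (𝓝 n) := by
      have : Tendsto (fun t => F (Ψ t)) l (𝓝 (∑ _i : Fin n, 1)) :=
        tendsto_finsetSum _ fun i _ => h i
      simpa using this
    rcases Set.eq_empty_or_nonempty (Vᶜ) with he | hne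
    · refine Filter.Eventually.of_forall fun t => ?_
      have : Ψ t ∈ V := by rw [Set.compl_empty_iff.1 he]; trivial
      exact this
    · obtain ⟨g, hg, hmax⟩ := hV.isClosed_compl.isCompact.exists_isMaxOn hne hF.continuousOn
      have hlt : F g < n := by
        refine lt_of_le_of_ne (hle g) fun heq => hg ?_
        have h1 : ∑ i, g.1 i (w i) ^ 2 = ∑ _i : Fin n, (1 : ℝ) := by simpa using heq
        have h2 := (Finset.sum_eq_sum_iff_of_le fun i _ => SO.sq_le_one g i (w i)).1 h1
        have h3 : (g : Flag n) = permPoint w :=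
          (coe_eq_permPoint_iff g w).2 fun i => h2 i (Finset.mem_univ i)
        change (g : Flag n) ∈ U
        rw [h3]
        exact hw
      filter_upwards [hlim.eventually (lt_mem_nhds hlt)] with t ht
      by_contra hnot
      exact absurd (hmax (show Ψ t ∈ Vᶜ from hnot)) (not_le.2 ht)

/-- The limits of a lifted path at points `permPoint w` are unique. -/
theorem permPoint_unique {n : ℕ} [NeZero n] {l : Filter ℝ} [l.NeBot] {γ : ℝ → Flag n}
    {v w : Equiv.Perm (Fin n)} (hv : Tendsto γ l (𝓝 (permPoint v)))
    (hw : Tendsto γ l (𝓝 (permPoint w))) : v = w := by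
  refine permPoint_injective ((coe_eq_permPoint_iff (signedPermMatrix v) w).2 fun i => ?_)
  have h1 := ((continuous_sqEntry i (w i)).tendsto _).comp hv
  have h2 := ((continuous_sqEntry i (w i)).tendsto _).comp hw
  have h3 := tendsto_nhds_unique h1 h2
  have h4 : sqEntry i (w i) (permPoint w) = 1 := signedPermMatrix_sq w i
  rw [h4] at h3
  exact h3

/-! ### The Toda field and the asymptotics of its solutions. -/

theorem laxMatrix_mul {n : ℕ} (lam : Fin n → ℝ) (g : SO n) :
    laxMatrix lam g.1 * g.1 = g.1 * Matrix.diagonal lam := by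
  rw [laxMatrix, mul_assoc, SO.transpose_mul, mul_one]

theorem laxMatrix_apply {n : ℕ} (lam : Fin n → ℝ) (M : Matrix (Fin n) (Fin n) ℝ) (i j : Fin n) :
    laxMatrix lam M i j = ∑ a, M i a * lam a * M j a := by
  simp [laxMatrix, Matrix.mul_apply, Matrix.diagonal_apply]

theorem laxMatrix_symm {n : ℕ} (lam : Fin n → ℝ) (M : Matrix (Fin n) (Fin n) ℝ) (i j : Fin n) :
    laxMatrix lam M i j = laxMatrix lam M j i := by
  rw [laxMatrix_apply, laxMatrix_apply]
  exact Finset.sum_congr rfl fun a _ => by ring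

theorem laxMatrix_neg {n : ℕ} (lam : Fin n → ℝ) (M : Matrix (Fin n) (Fin n) ℝ) :
    laxMatrix (-lam) M = -laxMatrix lam M := by
  ext i j
  simp [laxMatrix_apply]

theorem antisymmetrization_neg {n : ℕ} (L : Matrix (Fin n) (Fin n) ℝ) :
    antisymmetrization (-L) = -antisymmetrization L := by
  ext i j
  simp only [antisymmetrization, Matrix.of_apply, Matrix.neg_apply]
  split_ifs <;> simp

theorem todaField_neg {n : ℕ} (lam : Fin n → ℝ) (M : Matrix (Fin n) (Fin n) ℝ) :
    todaField (-lam) M = -todaField lam M := by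
  rw [todaField, todaField, laxMatrix_neg, antisymmetrization_neg, neg_mul]

theorem IsSolution.reverse {n : ℕ} {lam : Fin n → ℝ} {Ψ : ℝ → SO n} (h : IsSolution lam Ψ) :
    IsSolution (-lam) (fun t => Ψ (-t)) := by
  intro t i j
  rw [todaField_neg, Matrix.neg_apply]
  simpa [Function.comp_def] using (h (-t) i j).scomp t (hasDerivAt_neg t)

theorem IsSolution.shift {n : ℕ} {lam : Fin n → ℝ} {Ψ : ℝ → SO n} (h : IsSolution lam Ψ) (s : ℝ) :
    IsSolution lam (fun t => Ψ (t + s)) := fun t i j => (h (t + s) i j).comp_add_const t s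

/-- A linear scalar equation has only the zero solution with the initial value `0`. -/
theorem eq_zero_of_hasDerivAt_mul {a y : ℝ → ℝ} (ha : Continuous a)
    (hy : ∀ t, HasDerivAt y (a t * y t) t) (h0 : y 0 = 0) (t : ℝ) : y t = 0 := by
  let F : ℝ → ℝ := fun t => ∫ s in (0 : ℝ)..t, a s
  have hF : ∀ t, HasDerivAt F (a t) t := fun t =>
    intervalIntegral.integral_hasDerivAt_right (ha.intervalIntegrable _ _)
      (ha.stronglyMeasurableAtFilter _ _) ha.continuousAt
  have hd : ∀ t, HasDerivAt (fun t => y t * Real.exp (-F t)) 0 t := by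
    intro t
    exact ((hy t).mul (hF t).fun_neg.exp).congr_deriv (by ring)
  have hc := is_const_of_deriv_eq_zero (fun t => (hd t).differentiableAt)
    (fun t => (hd t).deriv) t 0
  simp only [h0, zero_mul] at hc
  exact (mul_eq_zero.1 hc).resolve_right (Real.exp_ne_zero _)

theorem antisymmetrization_add_lower {n : ℕ} (L : Matrix (Fin n) (Fin n) ℝ) {k l : Fin n}
    (h : l < k) : (antisymmetrization L + L) k l = 0 := by
  simp [antisymmetrization, h, h.not_gt]

theorem antisymmetrization_add_diag {n : ℕ} (L : Matrix (Fin n) (Fin n) ℝ) (k : Fin n) :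
    (antisymmetrization L + L) k k = L k k := by
  simp [antisymmetrization]

theorem IsSolution.continuous_entry {n : ℕ} {lam : Fin n → ℝ} {Ψ : ℝ → SO n}
    (h : IsSolution lam Ψ) (i j : Fin n) : Continuous fun t => (Ψ t).1 i j :=
  continuous_iff_continuousAt.2 fun t => (h t i j).continuousAt

/-- By `L Ψ = Ψ Λ`, the derivative of `Ψ exp(-tΛ)` is `-(A + L) Ψ exp(-tΛ)`, and `A + L` is upper
triangular: this is the integrability of the flow. -/
theorem todaField_sub_diagonal {n : ℕ} (lam : Fin n → ℝ) (g : SO n) (k a : Fin n) :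
    todaField lam g.1 k a - lam a * g.1 k a =
      -∑ l, (antisymmetrization (laxMatrix lam g.1) + laxMatrix lam g.1) k l * g.1 l a := by
  have h1 := congrFun (congrFun (laxMatrix_mul lam g) k) a
  rw [Matrix.mul_diagonal, Matrix.mul_apply] at h1
  rw [todaField, Matrix.neg_apply, Matrix.mul_apply, mul_comm (lam a), ← h1, ← neg_add',
    ← Finset.sum_add_distrib]
  simp only [Matrix.add_apply, add_mul]

/-- The rows of a solution `Ψ` are orthogonal to the lower rows of `Ψ 0 * exp (-t Λ)`. -/
theorem IsSolution.orthogonal_initial {n : ℕ} {lam : Fin n → ℝ} {Ψ : ℝ → SO n}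
    (h : IsSolution lam Ψ) (k : Fin n) : ∀ (i : Fin n), i < k → ∀ t : ℝ,
      ∑ a, (Ψ t).1 k a * Real.exp (-lam a * t) * (Ψ 0).1 i a = 0 := by
  -- Downward induction: in the equation for `c k` the terms with `l < k` vanish by triangularity
  -- and those with `l > k` by induction. A scalar linear equation with initial value `0` is left.
  induction k using WellFoundedGT.induction with
  | ind k ih =>
  intro i hik
  let c : Fin n → ℝ → ℝ := fun l t => ∑ a, (Ψ t).1 l a * Real.exp (-lam a * t) * (Ψ 0).1 i a
  have hc : ∀ t, HasDerivAt (c k) (-(laxMatrix lam (Ψ t).1 k k) * c k t) t := by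
    intro t
    have h1 : HasDerivAt (c k) (∑ a, (todaField lam (Ψ t).1 k a - lam a * (Ψ t).1 k a) *
        Real.exp (-lam a * t) * (Ψ 0).1 i a) t := by
      refine HasDerivAt.fun_sum fun a _ => ?_
      have h2 : HasDerivAt (fun t => Real.exp (-lam a * t)) (Real.exp (-lam a * t) * -lam a) t := by
        simpa using ((hasDerivAt_id t).const_mul (-lam a)).exp
      exact (((h t k a).mul h2).mul_const ((Ψ 0).1 i a)).congr_deriv (by ring)
    convert h1 using 1
    set K := antisymmetrization (laxMatrix lam (Ψ t).1) + laxMatrix lam (Ψ t).1 with hK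
    have h3 : ∑ a, (todaField lam (Ψ t).1 k a - lam a * (Ψ t).1 k a) *
        Real.exp (-lam a * t) * (Ψ 0).1 i a = -∑ l, K k l * c l t := by
      simp only [todaField_sub_diagonal, ← hK, c, neg_mul, Finset.sum_neg_distrib, Finset.sum_mul,
        Finset.mul_sum]
      rw [Finset.sum_comm]
      simp only [mul_assoc]
    rw [h3, Finset.sum_eq_single k, hK, antisymmetrization_add_diag, neg_mul]
    · intro l _ hl
      rcases lt_or_gt_of_ne hl with hlt | hgt
      · rw [hK, antisymmetrization_add_lower _ hlt, zero_mul]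
      · rw [show c l t = 0 from ih l hgt i (hik.trans hgt) t, mul_zero]
    · simp
  have hcont : Continuous fun t => -(laxMatrix lam (Ψ t).1 k k) := by
    simp only [laxMatrix_apply]
    exact (continuous_finsetSum _ fun a _ => ((h.continuous_entry k a).mul continuous_const).mul
      (h.continuous_entry k a)).neg
  have h0 : c k 0 = 0 := by
    have := congrFun (congrFun (SO.mul_transpose (Ψ 0)) k) i
    rw [Matrix.mul_apply, Matrix.one_apply_ne hik.ne'] at this
    simpa [c] using this
  exact fun t => eq_zero_of_hasDerivAt_mul hcont hc h0 t

/-- A family of orthogonal matrices, whose entries in the places `(k, w j)` with `j < k` tend to `0`,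
tends to the permutation matrix of `w` up to signs. -/
theorem tendsto_sq_of_tendsto_lower {n : ℕ} {l : Filter ℝ} (Ψ : ℝ → SO n) (w : Equiv.Perm (Fin n))
    (h : ∀ k j, j < k → Tendsto (fun t => (Ψ t).1 k (w j)) l (𝓝 0)) (k : Fin n) :
    Tendsto (fun t => (Ψ t).1 k (w k) ^ 2) l (𝓝 1) := by
  induction k using WellFoundedLT.induction with
  | ind k ih =>
  -- An earlier row has its whole mass at its own pivot in the limit, and a later row tends to `0`
  -- here by hypothesis; the unit norm of column `w k` then forces the claim.
  have hoff : ∀ j, j ≠ k → Tendsto (fun t => (Ψ t).1 j (w k) ^ 2) l (𝓝 0) := by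
    intro j hj
    rcases lt_or_gt_of_ne hj with hlt | hgt
    · have h1 : Tendsto (fun t => 1 - (Ψ t).1 j (w j) ^ 2) l (𝓝 0) := by
        simpa using (ih j hlt).const_sub 1
      refine squeeze_zero (fun _ => sq_nonneg _) (fun t => ?_) h1
      have h2 := SO.sum_row_sq (Ψ t) j
      have h3 : ∑ c ∈ {w k, w j}, (Ψ t).1 j c ^ 2 ≤ ∑ c, (Ψ t).1 j c ^ 2 :=
        Finset.sum_le_sum_of_subset_of_nonneg (Finset.subset_univ _) fun _ _ _ => sq_nonneg _
      rw [Finset.sum_pair (fun he => hj (w.injective he).symm)] at h3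
      linarith
    · simpa using (h j k hgt).pow 2
  have h1 : ∀ t, (Ψ t).1 k (w k) ^ 2 = 1 - ∑ j ∈ Finset.univ.erase k, (Ψ t).1 j (w k) ^ 2 := by
    intro t
    rw [← SO.sum_col_sq (Ψ t) (w k), ← Finset.add_sum_erase _ _ (Finset.mem_univ k)]
    ring
  simp only [h1]
  have h2 : Tendsto (fun t => ∑ j ∈ Finset.univ.erase k, (Ψ t).1 j (w k) ^ 2) l
      (𝓝 (∑ j ∈ Finset.univ.erase k, 0)) :=
    tendsto_finsetSum _ fun j hj => hoff j (Finset.ne_of_mem_erase hj)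
  simpa using h2.const_sub 1

theorem IsSolution.tendsto_atTop {n : ℕ} [NeZero n] {lam : Fin n → ℝ} {Ψ : ℝ → SO n}
    (hinj : Function.Injective lam) (h : IsSolution lam Ψ) {w : Equiv.Perm (Fin n)}
    (hw : InCell (-lam) w (Ψ 0).1) :
    Tendsto (fun t => (Ψ t : Flag n)) atTop (𝓝 (permPoint w)) := by
  refine (tendsto_permPoint_iff Ψ w).2 (tendsto_sq_of_tendsto_lower Ψ w fun k j hjk => ?_)
  obtain ⟨b, hb, -, hv, hne⟩ := hw
  set X := b * (Ψ 0).1 with hX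
  -- Row `j` of `X` combines rows `i ≤ j < k` of `Ψ 0`, to which the orthogonality applies. The
  -- factor `exp (lam (w j) * t)` makes the coefficient at `a = w j` constant.
  have horth : ∀ t, ∑ a, (Ψ t).1 k a * (X j a * Real.exp ((lam (w j) - lam a) * t)) = 0 := by
    intro t
    have h1 : ∀ a, (Ψ t).1 k a * (X j a * Real.exp ((lam (w j) - lam a) * t)) =
        ∑ i, Real.exp (lam (w j) * t) * b j i *
          ((Ψ t).1 k a * Real.exp (-lam a * t) * (Ψ 0).1 i a) := by
      intro a
      rw [hX, Matrix.mul_apply, sub_mul, sub_eq_add_neg, Real.exp_add, Finset.sum_mul,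
        Finset.mul_sum, neg_mul]
      exact Finset.sum_congr rfl fun i _ => by ring
    simp only [h1]
    rw [Finset.sum_comm]
    refine Finset.sum_eq_zero fun i _ => ?_
    rw [← Finset.mul_sum]
    rcases le_or_gt i j with hij | hij
    · rw [h.orthogonal_initial k i (lt_of_le_of_lt hij hjk) t, mul_zero]
    · rw [hb hij, mul_zero, zero_mul]
  -- Columns with smaller `lam` vanish in row `j` of `X` by the cell condition; for larger `lam` the
  -- exponential decays.
  have hlim : ∀ a, a ≠ w j → Tendsto (fun t => (Ψ t).1 k a *
      (X j a * Real.exp ((lam (w j) - lam a) * t))) atTop (𝓝 0) := by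
    intro a ha
    have h2 : Tendsto (fun t => X j a * Real.exp ((lam (w j) - lam a) * t)) atTop (𝓝 0) := by
      rcases lt_or_gt_of_ne (fun he => ha (hinj he) : lam a ≠ lam (w j)) with hlt | hgt
      · have : X j a = 0 := hv j a (neg_lt_neg hlt)
        simp [this]
      · have h3 : Tendsto (fun t : ℝ => (lam (w j) - lam a) * t) atTop atBot :=
          tendsto_id.const_mul_atTop_of_neg (sub_neg.2 hgt)
        simpa using (Real.tendsto_exp_atBot.comp h3).const_mul (X j a)
    refine squeeze_zero_norm (fun t => ?_) (by simpa only [norm_zero] using h2.norm)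
    rw [norm_mul]
    refine mul_le_of_le_one_left (norm_nonneg _) ?_
    rw [Real.norm_eq_abs]
    exact (sq_le_one_iff_abs_le_one _).1 (SO.sq_le_one (Ψ t) k a)
  have heq : ∀ t, (Ψ t).1 k (w j) = -(X j (w j))⁻¹ * ∑ a ∈ Finset.univ.erase (w j),
      (Ψ t).1 k a * (X j a * Real.exp ((lam (w j) - lam a) * t)) := by
    intro t
    have h1 := horth t
    rw [← Finset.add_sum_erase _ _ (Finset.mem_univ (w j)), sub_self, zero_mul, Real.exp_zero,
      mul_one] at h1
    rw [← neg_eq_of_add_eq_zero_right h1]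
    field_simp [hne j]
  simp only [heq]
  have := (tendsto_finsetSum (Finset.univ.erase (w j)) fun a ha =>
    hlim a (Finset.ne_of_mem_erase ha)).const_mul (-(X j (w j))⁻¹)
  simpa using this

/-- Reversing time amounts to negating `lam`. -/
theorem IsSolution.tendsto_atBot {n : ℕ} [NeZero n] {lam : Fin n → ℝ} {Ψ : ℝ → SO n}
    (hinj : Function.Injective lam) (h : IsSolution lam Ψ) {w : Equiv.Perm (Fin n)}
    (hw : InCell lam w (Ψ 0).1) :
    Tendsto (fun t => (Ψ t : Flag n)) atBot (𝓝 (permPoint w)) := by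
  have hinj' : Function.Injective (-lam) := neg_injective.comp hinj
  have h1 := h.reverse.tendsto_atTop (w := w) hinj' (by rwa [neg_neg, neg_zero])
  simpa [Function.comp_def] using h1.comp tendsto_neg_atBot_atTop

/-! ### Explicit solutions by the Gram-Schmidt process. -/

/-- The rows of a matrix as vectors of the Euclidean space. -/
noncomputable def euclideanRows {n : ℕ} (M : Matrix (Fin n) (Fin n) ℝ) (i : Fin n) :
    EuclideanSpace ℝ (Fin n) := WithLp.toLp 2 (M i)

theorem inner_euclideanRows {n : ℕ} (M : Matrix (Fin n) (Fin n) ℝ) (x : EuclideanSpace ℝ (Fin n))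
    (i : Fin n) : inner ℝ x (euclideanRows M i) = ∑ a, x a * M i a := by
  simp [PiLp.inner_apply, euclideanRows, mul_comm]

theorem linearIndependent_euclideanRows {n : ℕ} {M : Matrix (Fin n) (Fin n) ℝ} (hM : M.det ≠ 0) :
    LinearIndependent ℝ (euclideanRows M) := by
  have h := Matrix.linearIndependent_rows_of_det_ne_zero hM
  exact h.map' (WithLp.linearEquiv 2 ℝ (Fin n → ℝ)).symm.toLinearMap (LinearEquiv.ker _)

/-- The matrix whose rows result from those of `M` by the Gram-Schmidt process. -/
noncomputable def orthonormalizedRows {n : ℕ} (M : Matrix (Fin n) (Fin n) ℝ) :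
    Matrix (Fin n) (Fin n) ℝ :=
  Matrix.of fun i a => gramSchmidtNormed ℝ (euclideanRows M) i a

theorem orthonormalizedRows_mul_transpose {n : ℕ} {M : Matrix (Fin n) (Fin n) ℝ}
    (hM : M.det ≠ 0) : orthonormalizedRows M * (orthonormalizedRows M)ᵀ = 1 := by
  have h := gramSchmidtNormed_orthonormal (linearIndependent_euclideanRows hM)
  ext i j
  have h1 := (orthonormal_iff_ite.1 h) i j
  rw [Matrix.mul_apply, Matrix.one_apply, ← h1]
  simp [orthonormalizedRows, PiLp.inner_apply, mul_comm]

theorem orthonormalizedRows_orthogonal {n : ℕ} (M : Matrix (Fin n) (Fin n) ℝ) {i j : Fin n}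
    (hij : i < j) : ∑ a, orthonormalizedRows M j a * M i a = 0 := by
  have h := gramSchmidt_inv_triangular ℝ (euclideanRows M) hij
  have h1 : inner ℝ (gramSchmidtNormed ℝ (euclideanRows M) j) (euclideanRows M i) = 0 := by
    rw [gramSchmidtNormed, real_inner_smul_left, h, mul_zero]
  rwa [inner_euclideanRows] at h1

/-- Row `k` of the result lies in the span of the rows of `M` up to `k`, so its coordinates on later
rows, given by `M⁻¹`, vanish. -/
theorem orthonormalizedRows_eq_lower_mul {n : ℕ} {M : Matrix (Fin n) (Fin n) ℝ}
    (hM : M.det ≠ 0) :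
    ∃ b : Matrix (Fin n) (Fin n) ℝ, b.IsLowerTriangular ∧ orthonormalizedRows M = b * M := by
  have hu : IsUnit M.det := hM.isUnit
  refine ⟨orthonormalizedRows M * M⁻¹, fun k j hkj => ?_, ?_⟩
  · replace hkj : k < j := hkj
    have hmem : gramSchmidtNormed ℝ (euclideanRows M) k ∈
        Submodule.span ℝ (euclideanRows M '' Set.Iic k) := by
      rw [← span_gramSchmidt_Iic, ← span_gramSchmidtNormed]
      exact Submodule.subset_span ⟨k, Set.self_mem_Iic, rfl⟩
    have key : ∀ x ∈ Submodule.span ℝ (euclideanRows M '' Set.Iic k),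
        ∑ a, x a * M⁻¹ a j = 0 := by
      intro x hx
      induction hx using Submodule.span_induction with
      | mem x hx =>
        obtain ⟨i, hi, rfl⟩ := hx
        have h1 := congrFun (congrFun (Matrix.mul_nonsing_inv M hu) i) j
        rw [Matrix.mul_apply, Matrix.one_apply_ne (lt_of_le_of_lt hi hkj).ne] at h1
        exact h1
      | zero => simp
      | add x y _ _ hx hy => simp [add_mul, Finset.sum_add_distrib, hx, hy]
      | smul c x _ hx => simp [mul_assoc, ← Finset.mul_sum, hx]
    rw [Matrix.mul_apply]
    exact key _ hmem
  · rw [mul_assoc, Matrix.nonsing_inv_mul M hu, mul_one]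

theorem orthonormalizedRows_of_orthogonal {n : ℕ} {M : Matrix (Fin n) (Fin n) ℝ}
    (hM : M * Mᵀ = 1) : orthonormalizedRows M = M := by
  have h : ∀ i j, inner ℝ (euclideanRows M i) (euclideanRows M j) =
      (1 : Matrix (Fin n) (Fin n) ℝ) i j := by
    intro i j
    rw [← hM, inner_euclideanRows, Matrix.mul_apply]
    rfl
  have hg : gramSchmidt ℝ (euclideanRows M) = euclideanRows M :=
    gramSchmidt_of_orthogonal ℝ fun i j hij => (h i j).trans (Matrix.one_apply_ne hij)
  ext i a
  have hn : ‖euclideanRows M i‖ = 1 := by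
    rw [← sq_eq_sq₀ (norm_nonneg _) zero_le_one, ← real_inner_self_eq_norm_sq, h,
      Matrix.one_apply_eq, one_pow]
  simp only [orthonormalizedRows, Matrix.of_apply, gramSchmidtNormed, hg, hn]
  simp [euclideanRows]

theorem differentiable_gramSchmidt {n : ℕ} {f : ℝ → Fin n → EuclideanSpace ℝ (Fin n)}
    (hf : ∀ i, Differentiable ℝ fun t => f t i) (hli : ∀ t, LinearIndependent ℝ (f t)) (k : Fin n) :
    Differentiable ℝ fun t => gramSchmidt ℝ (f t) k := by
  induction k using WellFoundedLT.induction with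
  | ind k ih =>
  have h : ∀ t, gramSchmidt ℝ (f t) k = f t k - ∑ i ∈ Finset.Iio k,
      (inner ℝ (gramSchmidt ℝ (f t) i) (f t k) / ‖gramSchmidt ℝ (f t) i‖ ^ 2) •
        gramSchmidt ℝ (f t) i := fun t => eq_sub_of_add_eq (gramSchmidt_def'' ℝ (f t) k).symm
  simp only [h]
  refine (hf k).sub (Differentiable.fun_sum fun i hi => ?_)
  have hi' := ih i (Finset.mem_Iio.1 hi)
  refine Differentiable.smul (Differentiable.div (hi'.inner ℝ (hf k)) (hi'.norm_sq ℝ) fun t => ?_) hi'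
  exact pow_ne_zero _ (norm_ne_zero_iff.2 (gramSchmidt_ne_zero i (hli t)))

theorem differentiable_orthonormalizedRows {n : ℕ} {M : ℝ → Matrix (Fin n) (Fin n) ℝ}
    (hM : ∀ i j, Differentiable ℝ fun t => M t i j) (hdet : ∀ t, (M t).det ≠ 0) (i j : Fin n) :
    Differentiable ℝ fun t => orthonormalizedRows (M t) i j := by
  have hf : ∀ i, Differentiable ℝ fun t => euclideanRows (M t) i := fun i =>
    (differentiable_euclidean (𝕜 := ℝ)).2 fun j => hM i j
  have hli := fun t => linearIndependent_euclideanRows (hdet t)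
  have hg := differentiable_gramSchmidt hf hli i
  have hn : Differentiable ℝ fun t => gramSchmidtNormed ℝ (euclideanRows (M t)) i :=
    ((hg.norm ℝ fun t => gramSchmidt_ne_zero i (hli t)).inv fun t =>
      norm_ne_zero_iff.2 (gramSchmidt_ne_zero i (hli t))).smul hg
  exact (differentiable_euclidean (𝕜 := ℝ)).1 hn j

/-- Through each matrix of `SO_n(ℝ)` there is a solution of the Toda flow, which is defined for all
times. -/
theorem exists_isSolution {n : ℕ} (lam : Fin n → ℝ) (g : SO n) :
    ∃ Ψ : ℝ → SO n, IsSolution lam Ψ ∧ Ψ 0 = g := by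
  let M : ℝ → Matrix (Fin n) (Fin n) ℝ := fun t =>
    g.1 * Matrix.diagonal fun a => Real.exp (-lam a * t)
  have hMdet : ∀ t, (M t).det ≠ 0 := fun t => by
    rw [Matrix.det_mul, SO.det, one_mul, Matrix.det_diagonal]
    exact Finset.prod_ne_zero_iff.2 fun a _ => Real.exp_ne_zero _
  have hMd : ∀ i a t, HasDerivAt (fun t => M t i a) (-(M t i a * lam a)) t := by
    intro i a t
    have h2 : HasDerivAt (fun t => Real.exp (-lam a * t)) (Real.exp (-lam a * t) * -lam a) t := by
      simpa using ((hasDerivAt_id t).const_mul (-lam a)).exp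
    simp only [M, Matrix.mul_diagonal]
    exact (h2.const_mul (g.1 i a)).congr_deriv (by ring)
  let Q : ℝ → Matrix (Fin n) (Fin n) ℝ := fun t => orthonormalizedRows (M t)
  have hQQ : ∀ t, Q t * (Q t)ᵀ = 1 := fun t => orthonormalizedRows_mul_transpose (hMdet t)
  have hQd : ∀ i j, Differentiable ℝ fun t => Q t i j := fun i j =>
    differentiable_orthonormalizedRows (fun i a t => (hMd i a t).differentiableAt) hMdet i j
  have hQ0 : Q 0 = g.1 := by
    have h0 : M 0 = g.1 := by
      ext i a
      simp [M, Matrix.mul_diagonal]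
    change orthonormalizedRows (M 0) = g.1
    rw [h0, orthonormalizedRows_of_orthogonal (SO.mul_transpose g)]
  -- The determinant is continuous, has square `1` and starts at `1`, so it cannot change sign.
  have hdet : ∀ t, (Q t).det = 1 := by
    have hsq : ∀ t, (Q t).det * (Q t).det = 1 := fun t => by
      have := congrArg Matrix.det (hQQ t)
      rwa [Matrix.det_mul, Matrix.det_transpose, Matrix.det_one] at this
    have hcont : Continuous fun t => (Q t).det :=
      (continuous_matrix fun i j => (hQd i j).continuous).matrix_det
    intro t
    rcases mul_self_eq_one_iff.1 (hsq t) with h | h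
    · exact h
    · obtain ⟨s, hs⟩ := mem_range_of_exists_le_of_exists_ge (c := 0) hcont
        ⟨t, by rw [h]; norm_num⟩ ⟨0, by rw [hQ0, SO.det]; norm_num⟩
      have := hsq s
      rw [show (Q s).det = 0 from hs, mul_zero] at this
      exact absurd this zero_ne_one
  let Ψ : ℝ → SO n := fun t => ⟨Q t, Matrix.mem_specialOrthogonalGroup_iff.2
    ⟨(Matrix.mem_orthogonalGroup_iff _ _).2 (hQQ t), hdet t⟩⟩
  refine ⟨Ψ, fun t => ?_, Subtype.ext hQ0⟩
  let D : Matrix (Fin n) (Fin n) ℝ := Matrix.of fun i j => deriv (fun t => Q t i j) t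
  have hD : ∀ i j, HasDerivAt (fun t => Q t i j) (D i j) t := fun i j =>
    (hQd i j t).hasDerivAt
  have hanti : ∀ j k, (D * (Q t)ᵀ) j k = -(D * (Q t)ᵀ) k j := by
    intro j k
    have h1 : HasDerivAt (fun t => ∑ a, Q t j a * Q t k a)
        (∑ a, (D j a * Q t k a + Q t j a * D k a)) t :=
      HasDerivAt.fun_sum fun a _ => (hD j a).mul (hD k a)
    have h0 : (fun t => ∑ a, Q t j a * Q t k a) = fun _ => (1 : Matrix (Fin n) (Fin n) ℝ) j k :=
      funext fun t => by rw [← hQQ t]; rfl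
    rw [h0] at h1
    have h2 := h1.unique (hasDerivAt_const t _)
    rw [Finset.sum_add_distrib] at h2
    rw [Matrix.mul_apply, Matrix.mul_apply]
    simp only [Matrix.transpose_apply]
    rw [eq_neg_of_add_eq_zero_left h2]
    simp only [mul_comm]
  -- Differentiating the orthogonality of `Q_j` to `M_i`, `i < j`, moves the derivative to `M`,
  -- where it multiplies columns by `-lam`. Row `k` of `Q` is a combination of the `M_i` with `i ≤ k
  -- < j`. Antisymmetry gives the remaining entries of `D * Qᵀ`.
  have hlow : ∀ j k, k < j → (D * (Q t)ᵀ) j k = laxMatrix lam (Q t) j k := by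
    intro j k hkj
    have hrow : ∀ i, i < j → ∑ a, D j a * M t i a = ∑ a, Q t j a * lam a * M t i a := by
      intro i hij
      have h1 : HasDerivAt (fun t => ∑ a, Q t j a * M t i a)
          (∑ a, (D j a * M t i a + Q t j a * -(M t i a * lam a))) t :=
        HasDerivAt.fun_sum fun a _ => (hD j a).mul (hMd i a t)
      have h0 : (fun t => ∑ a, Q t j a * M t i a) = fun _ => 0 :=
        funext fun t => orthonormalizedRows_orthogonal (M t) hij
      rw [h0] at h1
      have h2 := h1.unique (hasDerivAt_const t _)
      rw [Finset.sum_add_distrib] at h2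
      rw [eq_neg_of_add_eq_zero_left h2, ← Finset.sum_neg_distrib]
      exact Finset.sum_congr rfl fun a _ => by ring
    obtain ⟨b, hb, hbM⟩ := orthonormalizedRows_eq_lower_mul (hMdet t)
    have hQk : ∀ a, Q t k a = ∑ i, b k i * M t i a := fun a => by
      change orthonormalizedRows (M t) k a = _
      rw [hbM, Matrix.mul_apply]
    have hexp : ∀ x : Fin n → ℝ, ∑ a, x a * Q t k a = ∑ i, b k i * ∑ a, x a * M t i a := by
      intro x
      simp only [hQk, Finset.mul_sum]
      rw [Finset.sum_comm]
      exact Finset.sum_congr rfl fun _ _ => Finset.sum_congr rfl fun _ _ => by ring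
    rw [laxMatrix_apply, Matrix.mul_apply]
    simp only [Matrix.transpose_apply]
    rw [hexp (D j), hexp fun a => Q t j a * lam a]
    refine Finset.sum_congr rfl fun i _ => ?_
    rcases le_or_gt i k with hik | hik
    · rw [hrow i (lt_of_le_of_lt hik hkj)]
    · rw [hb hik, zero_mul, zero_mul]
  have hDA : D * (Q t)ᵀ = -antisymmetrization (laxMatrix lam (Q t)) := by
    ext j k
    rw [Matrix.neg_apply, antisymmetrization, Matrix.of_apply]
    rcases lt_trichotomy j k with h | rfl | h
    · rw [if_pos h, hanti, hlow k j h, laxMatrix_symm]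
    · have := hanti j j
      simp only [lt_irrefl, if_false]
      linarith
    · rw [if_neg h.not_gt, if_pos h, hlow j k h, neg_neg]
  have hfield : todaField lam (Q t) = D := by
    rw [todaField, ← neg_mul, ← hDA, mul_assoc]
    rw [show (Q t)ᵀ * Q t = 1 from SO.transpose_mul (Ψ t), mul_one]
  intro i j
  change HasDerivAt (fun s => Q s i j) (todaField lam (Q t) i j) t
  rw [hfield]
  exact hD i j

/-! ### Singular points and connecting trajectories. -/

/-- At a zero, invertibility of `Ψ` gives `A = 0`, so the symmetric matrix `L` is diagonal. Then `L
Ψ = Ψ Λ` confines row `i` of `Ψ` to the only column whose eigenvalue is `L i i`. -/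
theorem bijOn_permPoint {n : ℕ} [NeZero n] {lam : Fin n → ℝ} (hinj : Function.Injective lam) :
    Set.BijOn (permPoint (n := n)) Set.univ {p | IsSingularPoint lam p} := by
  refine ⟨fun w _ => ⟨signedPermMatrix w, rfl, ?_⟩, permPoint_injective.injOn, ?_⟩
  · have hA : antisymmetrization (laxMatrix lam (signedPermMatrix w).1) = 0 := by
      have hz : ∀ i j, i ≠ j → laxMatrix lam (signedPermMatrix w).1 i j = 0 := by
        intro i j hij
        rw [laxMatrix_apply]
        refine Finset.sum_eq_zero fun a _ => ?_
        rw [signedPermMatrix_apply, signedPermMatrix_apply]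
        by_cases h1 : w i = a
        · have h2 : w j ≠ a := fun h2 => hij (w.injective (h1.trans h2.symm))
          simp [h2]
        · simp [h1]
      ext i j
      rw [antisymmetrization, Matrix.of_apply, Matrix.zero_apply]
      split_ifs with h1 h2
      · exact hz i j h1.ne
      · rw [hz i j h2.ne', neg_zero]
      · rfl
    rw [todaField, hA, zero_mul, neg_zero]
  · rintro p ⟨Ψ, rfl, hΨ⟩
    have hA : antisymmetrization (laxMatrix lam Ψ.1) = 0 := by
      have h1 : antisymmetrization (laxMatrix lam Ψ.1) * Ψ.1 = 0 := neg_eq_zero.1 hΨ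
      rw [← mul_one (antisymmetrization _), ← SO.mul_transpose Ψ, ← mul_assoc, h1, zero_mul]
    have hL : ∀ i j, i ≠ j → laxMatrix lam Ψ.1 i j = 0 := by
      have hlt : ∀ i j, i < j → laxMatrix lam Ψ.1 i j = 0 := by
        intro i j hij
        have := congrFun (congrFun hA i) j
        rwa [antisymmetrization, Matrix.of_apply, if_pos hij] at this
      intro i j hij
      rcases lt_or_gt_of_ne hij with h | h
      · exact hlt i j h
      · rw [laxMatrix_symm, hlt j i h]
    have heig : ∀ i a, Ψ.1 i a ≠ 0 → laxMatrix lam Ψ.1 i i = lam a := by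
      intro i a ha
      have h1 := congrFun (congrFun (laxMatrix_mul lam Ψ) i) a
      rw [Matrix.mul_diagonal, Matrix.mul_apply, Finset.sum_eq_single i, mul_comm] at h1
      · exact mul_left_cancel₀ ha h1
      · intro j _ hj
        rw [hL i j hj.symm, zero_mul]
      · simp
    have hex : ∀ i, ∃ a, Ψ.1 i a ≠ 0 := by
      intro i
      by_contra! h
      have := SO.sum_row_sq Ψ i
      simp [h] at this
    choose w hw using hex
    have huniq : ∀ i a, Ψ.1 i a ≠ 0 → a = w i := fun i a ha =>
      hinj ((heig i a ha).symm.trans (heig i (w i) (hw i)))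
    have hwinj : Function.Injective w := by
      intro i j hij
      by_contra hne
      have h1 := congrFun (congrFun (SO.mul_transpose Ψ) i) j
      rw [Matrix.mul_apply, Matrix.one_apply_ne hne, Finset.sum_eq_single (w i)] at h1
      · rw [Matrix.transpose_apply] at h1
        refine (mul_ne_zero (hw i) ?_) h1
        rw [hij]
        exact hw j
      · intro a _ ha
        rw [not_not.1 fun h => ha (huniq i a h), zero_mul]
      · simp
    refine ⟨Equiv.ofBijective w (Finite.injective_iff_bijective.1 hwinj), trivial, ?_⟩
    refine ((coe_eq_permPoint_iff Ψ _).2 fun i => ?_).symm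
    rw [← SO.sum_row_sq Ψ i, Finset.sum_eq_single (w i)]
    · rfl
    · intro a _ ha
      rw [not_not.1 fun h => ha (huniq i a h)]
      simp
    · simp

/-- The matrix `b` is both lower triangular and orthogonal: its diagonal entries have squares at
most `1` with product `1`. This excludes non-constant trajectories from a singular point to itself.
-/
theorem coe_eq_permPoint_of_inCell {n : ℕ} [NeZero n] {lam : Fin n → ℝ}
    (hinj : Function.Injective lam) {w : Equiv.Perm (Fin n)} {g : SO n} (h₁ : InCell lam w g.1)
    (h₂ : InCell (-lam) w g.1) : (g : Flag n) = permPoint w := by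
  obtain ⟨b, hb, hbg⟩ := h₁.exists_lower_mul_eq_one hinj h₂
  set G := g.1.submatrix id w with hG
  have hGG : G * Gᵀ = 1 := by
    rw [hG, Matrix.transpose_submatrix, Matrix.submatrix_mul_equiv, SO.mul_transpose,
      Matrix.submatrix_id_id]
  have hbG : b = Gᵀ := by
    rw [← mul_one b, ← hGG, ← mul_assoc, hbg, one_mul]
  have hsum : ∀ i, ∑ j, b i j ^ 2 = 1 := by
    intro i
    rw [← SO.sum_col_sq g (w i), hbG]
    rfl
  have hle : ∀ i, b i i ^ 2 ≤ 1 := by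
    intro i
    rw [← hsum i]
    exact Finset.single_le_sum (f := fun j => b i j ^ 2) (fun _ _ => sq_nonneg _)
      (Finset.mem_univ i)
  have hprod : ∏ i, b i i ^ 2 = 1 := by
    have h1 := congrArg Matrix.det hGG
    rw [Matrix.det_mul, Matrix.det_one, Matrix.det_transpose, ← sq, ← Matrix.det_transpose, ← hbG,
      Matrix.det_of_isLowerTriangular _ hb, ← Finset.prod_pow] at h1
    exact h1
  refine (coe_eq_permPoint_iff g w).2 fun i => ?_
  have hgi : g.1 i (w i) = b i i := by rw [hbG]; rfl
  rw [hgi]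
  refine le_antisymm (hle i) ?_
  rw [← hprod, ← Finset.mul_prod_erase _ _ (Finset.mem_univ i)]
  exact mul_le_of_le_one_right (sq_nonneg _)
    (Finset.prod_le_one (fun _ _ => sq_nonneg _) fun j _ => hle j)

/-- The point at time `s` lies in some cell, and that cell determines the limit; uniqueness of
limits identifies it. -/
theorem IsSolution.inCell_of_tendsto_atTop {n : ℕ} [NeZero n] {lam : Fin n → ℝ} {Ψ : ℝ → SO n}
    (hinj : Function.Injective lam) (h : IsSolution lam Ψ) {w : Equiv.Perm (Fin n)}
    (hw : Tendsto (fun t => (Ψ t : Flag n)) atTop (𝓝 (permPoint w))) (s : ℝ) :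
    InCell (-lam) w (Ψ s).1 := by
  have hinj' : Function.Injective (-lam) := neg_injective.comp hinj
  obtain ⟨u, hu⟩ := exists_inCell hinj' (Ψ s).1 (by rw [SO.det]; exact one_ne_zero)
  have h1 := (h.shift s).tendsto_atTop hinj (w := u) (by rwa [zero_add])
  have h2 := hw.comp (tendsto_atTop_add_const_right atTop s tendsto_id)
  rwa [permPoint_unique h2 h1]

theorem IsSolution.inCell_of_tendsto_atBot {n : ℕ} [NeZero n] {lam : Fin n → ℝ} {Ψ : ℝ → SO n}
    (hinj : Function.Injective lam) (h : IsSolution lam Ψ) {w : Equiv.Perm (Fin n)}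
    (hw : Tendsto (fun t => (Ψ t : Flag n)) atBot (𝓝 (permPoint w))) (s : ℝ) :
    InCell lam w (Ψ s).1 := by
  obtain ⟨u, hu⟩ := exists_inCell hinj (Ψ s).1 (by rw [SO.det]; exact one_ne_zero)
  have h1 := (h.shift s).tendsto_atBot hinj (w := u) (by rwa [zero_add])
  have h2 := hw.comp (tendsto_atBot_add_const_right atBot s tendsto_id)
  rwa [permPoint_unique h2 h1]

/-- The trajectories from `permPoint v` to `permPoint w` span the intersection of two opposite
Bruhat cells. -/
theorem mem_flowSpace_iff {n : ℕ} [NeZero n] {lam : Fin n → ℝ} (hinj : Function.Injective lam)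
    (g : SO n) (v w : Equiv.Perm (Fin n)) :
    (g : Flag n) ∈ flowSpace lam (permPoint v) (permPoint w) ↔
      InCell lam v g.1 ∧ InCell (-lam) w g.1 ∧ v ≠ w := by
  constructor
  · rintro ⟨γ, ⟨⟨Ψ, hΨ, hγ⟩, ⟨s, s', hne⟩, hbot, htop⟩, t, ht⟩
    obtain rfl : γ = fun t => (Ψ t : Flag n) := funext hγ
    obtain ⟨d, hd, hg⟩ := (flag_eq_iff (Ψ t) g).1 ht
    have hd0 : ∀ i, d i ≠ 0 := fun i h0 => by simpa [h0] using hd i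
    have hv := hΨ.inCell_of_tendsto_atBot hinj hbot
    have hw := hΨ.inCell_of_tendsto_atTop hinj htop
    rw [hg]
    refine ⟨(hv t).mul_diagonal d hd0, (hw t).mul_diagonal d hd0, ?_⟩
    rintro rfl
    have hconst := fun t => coe_eq_permPoint_of_inCell hinj (hv t) (hw t)
    exact hne ((hconst s).trans (hconst s').symm)
  · rintro ⟨hv, hw, hne⟩
    obtain ⟨Ψ, hΨ, rfl⟩ := exists_isSolution lam g
    have htop := hΨ.tendsto_atTop hinj hw
    have hbot := hΨ.tendsto_atBot hinj hv
    refine ⟨fun t => (Ψ t : Flag n), ⟨⟨Ψ, hΨ, fun _ => rfl⟩, ?_, hbot, htop⟩, 0, rfl⟩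
    -- A constant trajectory must sit at its limit `permPoint v`, as squares of entries show; then
    -- both limits would coincide.
    by_contra! hconst
    refine hne (permPoint_unique (l := atTop) ?_ htop)
    have h1 : (fun t => (Ψ t : Flag n)) = fun _ => (Ψ 0 : Flag n) := funext fun t => hconst t 0
    rw [h1] at hbot ⊢
    rw [(coe_eq_permPoint_iff (Ψ 0) v).2 fun i => ?_]
    · exact tendsto_const_nhds
    · have h2 := ((continuous_sqEntry i (v i)).tendsto _).comp hbot
      exact (tendsto_nhds_unique h2 tendsto_const_nhds).symm.trans (signedPermMatrix_sq v i)

theorem exists_isConnecting_iff {n : ℕ} {lam : Fin n → ℝ} (x y : Flag n) :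
    (∃ γ : ℝ → Flag n, IsConnecting lam x y γ) ↔ (flowSpace lam x y).Nonempty :=
  ⟨fun ⟨γ, hγ⟩ => ⟨γ 0, γ, hγ, 0, rfl⟩, fun ⟨_, γ, hγ, _⟩ => ⟨γ, hγ⟩⟩

/-! ### Tangent spaces and dimension of submanifolds. -/

section Submanifold

variable {E : Type*} [NormedAddCommGroup E] [NormedSpace ℝ E]

/-- Vectors tangent to the zero set of `f` are tangent to each larger smooth zero set. -/
theorem ker_fderiv_le_ker_fderiv [FiniteDimensional ℝ E] {m₁ m₂ : ℕ} {f₁ : E → Fin m₁ → ℝ} {f₂ : E → Fin m₂ → ℝ}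
    {U₁ U₂ S : Set E} {p : E} (hU₁ : IsOpen U₁) (hU₂ : IsOpen U₂) (hp₁ : p ∈ U₁) (hp₂ : p ∈ U₂)
    (hpS : p ∈ S) (hf₁ : ContDiffOn ℝ ∞ f₁ U₁) (hf₂ : ContDiffOn ℝ ∞ f₂ U₂)
    (hs : Function.Surjective (fderiv ℝ f₁ p)) (hS₁ : S ∩ U₁ = {q ∈ U₁ | f₁ q = 0})
    (hS₂ : S ∩ U₂ = {q ∈ U₂ | f₂ q = 0}) :
    (fderiv ℝ f₁ p).ker ≤ (fderiv ℝ f₂ p).ker := by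
  have : CompleteSpace E := FiniteDimensional.complete ℝ E
  have hstrict : HasStrictFDerivAt f₁ (fderiv ℝ f₁ p) p :=
    (hf₁.contDiffAt (hU₁.mem_nhds hp₁)).hasStrictFDerivAt (by simp)
  have hrange : (fderiv ℝ f₁ p).range = ⊤ := LinearMap.range_eq_top.2 hs
  have hf₁p : f₁ p = 0 := (hS₁.subset ⟨hpS, hp₁⟩).2
  let φ := hstrict.implicitFunction f₁ (fderiv ℝ f₁ p) hrange (f₁ p)
  have hφ0 : φ 0 = p := hstrict.implicitFunction_apply_image hrange
  have hφ : HasStrictFDerivAt φ (fderiv ℝ f₁ p).ker.subtypeL 0 := hstrict.to_implicitFunction hrange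
  have hφt : Tendsto φ (𝓝 0) (𝓝 p) := by
    have := hφ.hasFDerivAt.continuousAt.tendsto
    rwa [hφ0] at this
  have hmap : ∀ᶠ y in 𝓝 (0 : (fderiv ℝ f₁ p).ker), f₁ (φ y) = f₁ p := by
    have h1 : Tendsto (fun y : (fderiv ℝ f₁ p).ker => (f₁ p, y)) (𝓝 0) (𝓝 (f₁ p, 0)) :=
      tendsto_const_nhds.prodMk_nhds tendsto_id
    exact h1.eventually (hstrict.map_implicitFunction_eq hrange)
  -- `φ` parametrises the zero set of `f₁` with the inclusion of the kernel as derivative at `0`;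
  -- differentiating `f₂ ∘ φ = 0` there gives the claim.
  have hzero : (fun y => f₂ (φ y)) =ᶠ[𝓝 0] fun _ => 0 := by
    filter_upwards [hmap, hφt.eventually (hU₁.mem_nhds hp₁), hφt.eventually (hU₂.mem_nhds hp₂)]
      with y h1 h2 h3
    have h4 : φ y ∈ S ∩ U₁ := hS₁.superset ⟨h2, h1.trans hf₁p⟩
    exact (hS₂.subset ⟨h4.1, h3⟩).2
  have hf₂d : HasFDerivAt f₂ (fderiv ℝ f₂ p) (φ 0) := by
    rw [hφ0]
    exact ((hf₂.contDiffAt (hU₂.mem_nhds hp₂)).differentiableAt (by simp)).hasFDerivAt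
  have hcomp := (hf₂d.comp 0 hφ.hasFDerivAt).congr_of_eventuallyEq hzero.symm
  have h0 := hcomp.unique (hasFDerivAt_const (0 : Fin m₂ → ℝ) 0)
  intro x hx
  have := DFunLike.congr_fun h0 ⟨x, hx⟩
  simpa using this

/-- The dimension of a nonempty submanifold is determined. -/
theorem IsEmbeddedSubmanifold.dim_unique [FiniteDimensional ℝ E] {k₁ k₂ : ℕ} {S : Set E} (hS : S.Nonempty)
    (h₁ : IsEmbeddedSubmanifold k₁ S) (h₂ : IsEmbeddedSubmanifold k₂ S) : k₁ = k₂ := by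
  obtain ⟨p, hp⟩ := hS
  obtain ⟨U₁, m₁, f₁, hU₁, hp₁, hm₁, hf₁, hs₁, hS₁⟩ := h₁ p hp
  obtain ⟨U₂, m₂, f₂, hU₂, hp₂, hm₂, hf₂, hs₂, hS₂⟩ := h₂ p hp
  have hker : (fderiv ℝ f₁ p).ker = (fderiv ℝ f₂ p).ker := le_antisymm
    (ker_fderiv_le_ker_fderiv hU₁ hU₂ hp₁ hp₂ hp hf₁ hf₂ hs₁ hS₁ hS₂)
    (ker_fderiv_le_ker_fderiv hU₂ hU₁ hp₂ hp₁ hp hf₂ hf₁ hs₂ hS₂ hS₁)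
  have hrank : ∀ (m : ℕ) (L : E →L[ℝ] Fin m → ℝ), Function.Surjective L →
      m + Module.finrank ℝ L.ker = Module.finrank ℝ E := by
    intro m L hL
    have h1 := LinearMap.finrank_range_add_finrank_ker L.toLinearMap
    rw [LinearMap.range_eq_top.2 hL, finrank_top, Module.finrank_fin_fun] at h1
    exact h1
  have h1 := hrank m₁ _ hs₁
  have h2 := hrank m₂ _ hs₂
  rw [hker] at h1
  omega

theorem isEmbeddedSubmanifold_of_fintype {k : ℕ} {S : Set E}
    (h : ∀ p ∈ S, ∃ (U : Set E) (I : Type) (_ : Fintype I) (f : I → E → ℝ), IsOpen U ∧ p ∈ U ∧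
      Fintype.card I + k = Module.finrank ℝ E ∧ (∀ i, ContDiff ℝ ∞ (f i)) ∧
      (∀ c : I → ℝ, ∃ z, ∀ i, fderiv ℝ (f i) p z = c i) ∧
      ∀ q ∈ U, q ∈ S ↔ ∀ i, f i q = 0) :
    IsEmbeddedSubmanifold k S := by
  intro p hp
  obtain ⟨U, I, _, f, hU, hpU, hcard, hf, hs, hS⟩ := h p hp
  let e := Fintype.equivFin I
  refine ⟨U, Fintype.card I, fun q j => f (e.symm j) q, hU, hpU, hcard,
    (contDiff_pi.2 fun j => hf (e.symm j)).contDiffOn, ?_, ?_⟩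
  · rw [fderiv_pi fun j => (hf (e.symm j)).differentiable (by simp) p]
    intro c
    obtain ⟨z, hz⟩ := hs fun i => c (e i)
    refine ⟨z, funext fun j => ?_⟩
    simp [hz]
  · ext q
    simp only [Set.mem_inter_iff, Set.mem_ofPred_eq]
    constructor
    · rintro ⟨h1, h2⟩
      exact ⟨h2, funext fun j => (hS q h2).1 h1 _⟩
    · rintro ⟨h1, h2⟩
      exact ⟨(hS q h1).2 fun i => by simpa using congrFun h2 (e i), h1⟩

theorem fderiv_eq_of_hasDerivAt {f : E → ℝ} (hf : ContDiff ℝ ∞ f) {p z : E} {c : ℝ}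
    (h : HasDerivAt (fun s : ℝ => f (p + s • z)) c 0) : fderiv ℝ f p z = c :=
  ((hf.differentiable (by simp) p).hasFDerivAt.hasLineDerivAt z).unique h

end Submanifold

/-! ### Equations of the cells and their transversality. -/

/-- The minor of the first rows of `q` which vanishes on the cell of `w`, where the column `w i` is
exchanged for the higher column `w j`. -/
noncomputable def cellMinor {n : ℕ} (w : Equiv.Perm (Fin n)) (i j : Fin n)
    (q : Fin n → Fin n → ℝ) : ℝ :=
  leadDet i ((Matrix.of q).submatrix id (w * Equiv.swap i j : Equiv.Perm (Fin n)))

theorem contDiff_leadDet_submatrix {n : ℕ} (i : Fin n) (u : Equiv.Perm (Fin n)) :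
    ContDiff ℝ ∞ fun q : Fin n → Fin n → ℝ => leadDet i ((Matrix.of q).submatrix id u) := by
  simp only [leadDet, Matrix.det_apply]
  refine ContDiff.sum fun π _ => ContDiff.const_smul _ (contDiff_prod fun a _ => ?_)
  exact contDiff_apply_apply ℝ ℝ ((π a : {a // a ≤ i}) : Fin n) (u a)

theorem contDiff_cellMinor {n : ℕ} (w : Equiv.Perm (Fin n)) (i j : Fin n) :
    ContDiff ℝ ∞ (cellMinor w i j) := contDiff_leadDet_submatrix i _

theorem cellMinor_lower_mul {n : ℕ} (w : Equiv.Perm (Fin n)) (i j : Fin n)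
    {b : Matrix (Fin n) (Fin n) ℝ} (hb : b.IsLowerTriangular) (q : Matrix (Fin n) (Fin n) ℝ) :
    cellMinor w i j (b * q) = leadDet i b * cellMinor w i j q := by
  unfold cellMinor
  rw [← leadDet_mul_of_lower i hb, ← submatrix_mul_left]
  rfl

/-- Moving along `(1 + s ξ) p` only multiplies the minor, which is zero, by a factor. -/
theorem fderiv_cellMinor_lower_mul {n : ℕ} {w : Equiv.Perm (Fin n)} {i j : Fin n}
    {p : Matrix (Fin n) (Fin n) ℝ} (hp : cellMinor w i j p = 0) {ξ : Matrix (Fin n) (Fin n) ℝ}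
    (hξ : ξ.IsLowerTriangular) :
    fderiv ℝ (cellMinor w i j) p (ξ * p : Matrix (Fin n) (Fin n) ℝ) = 0 := by
  refine fderiv_eq_of_hasDerivAt (contDiff_cellMinor w i j) ?_
  have h : ∀ s : ℝ, cellMinor w i j (p + s • (ξ * p) : Matrix (Fin n) (Fin n) ℝ) = 0 := by
    intro s
    have h1 : p + s • (ξ * p) = (1 + s • ξ) * p := by rw [add_mul, one_mul, smul_mul_assoc]
    have h2 : (1 + s • ξ).IsLowerTriangular := by
      intro a b hab
      rw [Matrix.add_apply, Matrix.smul_apply, hξ hab, smul_zero, add_zero]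
      exact Matrix.one_apply_ne (ne_of_lt hab)
    rw [h1, cellMinor_lower_mul w i j h2, hp, mul_zero]
  exact (hasDerivAt_const (0 : ℝ) (0 : ℝ)).congr_of_eventuallyEq (Eventually.of_forall h)

/-- Right multiplication by `1 + s Y` creates no entries above the pivots when `Y` sends no column
to a higher one, so the minor stays zero. -/
theorem fderiv_cellMinor_mul {n : ℕ} {h : Fin n → ℝ} {w : Equiv.Perm (Fin n)} {i j : Fin n}
    (hij : i < j) (hlt : h (w i) < h (w j)) {p : Matrix (Fin n) (Fin n) ℝ} (hp : InCell h w p)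
    {Y : Matrix (Fin n) (Fin n) ℝ} (hY : ∀ c d, h c < h d → Y c d = 0) :
    fderiv ℝ (cellMinor w i j) p (p * Y : Matrix (Fin n) (Fin n) ℝ) = 0 := by
  obtain ⟨b, hb, hd, hv, -⟩ := hp
  refine fderiv_eq_of_hasDerivAt (contDiff_cellMinor w i j) ?_
  have h : ∀ s : ℝ, cellMinor w i j (p + s • (p * Y) : Matrix (Fin n) (Fin n) ℝ) = 0 := by
    intro s
    have h1 : VanishAbove h w (b * (p + s • (p * Y))) := by
      intro k c hc
      have h3 : b * (p + s • (p * Y)) = b * p + s • (b * p * Y) := by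
        rw [mul_add, mul_smul_comm, mul_assoc]
      rw [h3, Matrix.add_apply, Matrix.smul_apply, hv k c hc, zero_add, Matrix.mul_apply,
        Finset.sum_eq_zero, smul_zero]
      intro a _
      rcases le_or_gt (h a) (h (w k)) with ha | ha
      · rw [hY a c (lt_of_le_of_lt ha hc), mul_zero]
      · rw [hv k a ha, zero_mul]
    have h2 := cellMinor_lower_mul w i j hb (p + s • (p * Y))
    rw [show cellMinor w i j (b * (p + s • (p * Y)) : Matrix (Fin n) (Fin n) ℝ) = 0 from
      leadDet_swap_eq_zero h1 hij hlt] at h2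
    exact (mul_eq_zero.1 h2.symm).resolve_left (leadDet_ne_zero_of_lower i hb hd)
  exact (hasDerivAt_const (0 : ℝ) (0 : ℝ)).congr_of_eventuallyEq (Eventually.of_forall h)

/-- The pairs of places which index the equations of the cell of `w`. -/
abbrev CellPairs {n : ℕ} (h : Fin n → ℝ) (w : Equiv.Perm (Fin n)) : Type :=
  {x : Fin n × Fin n // x.1 < x.2 ∧ h (w x.1) < h (w x.2)}

theorem exists_fderiv_cellMinor_eq {n : ℕ} {h : Fin n → ℝ} (hinj : Function.Injective h)
    {w : Equiv.Perm (Fin n)} {p : Matrix (Fin n) (Fin n) ℝ} (hp : InCell h w p)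
    (c : CellPairs h w → ℝ) :
    ∃ z : Matrix (Fin n) (Fin n) ℝ,
      ∀ x : CellPairs h w, fderiv ℝ (cellMinor w x.1.1 x.1.2) p z = c x := by
  classical
  obtain ⟨hne, hz⟩ := (inCell_iff_leadDet hinj w p).1 hp
  obtain ⟨b, hb, hd, hup, hone⟩ := exists_lower_mul_eq_upper _ hne
  have hβ : ∀ i, leadDet i b ≠ 0 := fun i => leadDet_ne_zero_of_lower i hb hd
  have hvan : ∀ x : CellPairs h w, cellMinor w x.1.1 x.1.2 p = 0 := fun x =>
    hz _ _ x.2.1 x.2.2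
  -- After normalisation by `b`, this direction changes only the entry `y` of an upper unitriangular
  -- matrix. The minor of `x` is that matrix's entry `x` up to the factor `(leadDet x.1.1 b)⁻¹`, so
  -- the table of derivatives is diagonal.
  let Z : CellPairs h w → Matrix (Fin n) (Fin n) ℝ := fun y =>
    b⁻¹ * Matrix.single y.1.1 (w y.1.2) 1
  have hbZ : ∀ (y : CellPairs h w) (s : ℝ), (b * (p + s • Z y)).submatrix id w =
      b * p.submatrix id w + s • Matrix.single y.1.1 y.1.2 1 := by
    intro y s
    have h1 : b * (p + s • Z y) = b * p + s • Matrix.single y.1.1 (w y.1.2) 1 := by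
      rw [mul_add, mul_smul_comm, ← mul_assoc, Matrix.mul_nonsing_inv b hd.isUnit, one_mul]
    rw [h1, ← submatrix_mul_left]
    ext i j
    simp [Matrix.single_apply]
  have hdir : ∀ x y : CellPairs h w, fderiv ℝ (cellMinor w x.1.1 x.1.2) p (Z y) =
      if y = x then (leadDet x.1.1 b)⁻¹ else 0 := by
    rintro ⟨⟨i, j⟩, hij, hlt⟩ ⟨⟨k, l⟩, hkl, hlt'⟩
    refine fderiv_eq_of_hasDerivAt (contDiff_cellMinor w i j) ?_
    dsimp only at hij hkl hlt hlt' ⊢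
    have hnij : (b * p.submatrix id w) i j = 0 := by
      have h1 := cellMinor_lower_mul w i j hb p
      rw [hvan ⟨⟨i, j⟩, hij, hlt⟩, mul_zero] at h1
      have h2 : cellMinor w i j (b * p : Matrix (Fin n) (Fin n) ℝ) =
          leadDet i ((b * p.submatrix id w).submatrix id (Equiv.swap i j)) := by
        rw [← submatrix_mul_left]; rfl
      rw [h2, leadDet_of_upper, Fintype.prod_eq_single (⟨i, le_rfl⟩ : {a // a ≤ i})] at h1
      · simpa using h1
      · rintro ⟨a, ha⟩ hne
        have hai : a ≠ i := fun he => hne (Subtype.ext he)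
        rw [Matrix.submatrix_apply, Equiv.swap_apply_of_ne_of_ne hai (lt_of_le_of_lt ha hij).ne]
        exact hone a
      · intro x y hyx hx hy
        rw [Matrix.submatrix_apply, Equiv.swap_apply_of_ne_of_ne (lt_of_lt_of_le hyx hx).ne
          (lt_of_le_of_lt hy hij).ne]
        exact hup x y hyx
    have hval : ∀ s : ℝ, cellMinor w i j (p + s • Z ⟨(k, l), hkl, hlt'⟩ :
        Matrix (Fin n) (Fin n) ℝ) = s * if k = i ∧ l = j then (leadDet i b)⁻¹ else 0 := by
      intro s
      have h1 := cellMinor_lower_mul w i j hb (p + s • Z ⟨(k, l), hkl, hlt'⟩)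
      have h2 : cellMinor w i j (b * (p + s • Z ⟨(k, l), hkl, hlt'⟩) :
          Matrix (Fin n) (Fin n) ℝ) =
          leadDet i ((b * p.submatrix id w + s • Matrix.single k l 1).submatrix id
            (Equiv.swap i j)) := by
        rw [← hbZ ⟨(k, l), hkl, hlt'⟩ s]; rfl
      have hup' : ∀ x y, y ≤ x → (s • Matrix.single k l (1 : ℝ)) x y = 0 := by
        intro x y hyx
        rw [Matrix.smul_apply, Matrix.single_apply, if_neg, smul_zero]
        rintro ⟨rfl, rfl⟩
        exact absurd hkl (not_lt.2 hyx)
      rw [h2, leadDet_of_upper, Fintype.prod_eq_single (⟨i, le_rfl⟩ : {a // a ≤ i})] at h1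
      · rw [Matrix.submatrix_apply, Equiv.swap_apply_left, id, Matrix.add_apply, hnij, zero_add,
          Matrix.smul_apply, Matrix.single_apply, smul_eq_mul] at h1
        rw [← mul_right_inj' (hβ i), ← h1]
        split_ifs
        · field_simp [hβ i]
        · simp
      · rintro ⟨a, ha⟩ hne
        have hai : a ≠ i := fun he => hne (Subtype.ext he)
        rw [Matrix.submatrix_apply, Equiv.swap_apply_of_ne_of_ne hai (lt_of_le_of_lt ha hij).ne,
          id, Matrix.add_apply, hone, hup' a a le_rfl, add_zero]
      · intro x y hyx hx hy
        rw [Matrix.submatrix_apply, Equiv.swap_apply_of_ne_of_ne (lt_of_lt_of_le hyx hx).ne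
          (lt_of_le_of_lt hy hij).ne, id, Matrix.add_apply, hup x y hyx, hup' x y hyx.le, add_zero]
    have hiff : ((⟨(k, l), hkl, hlt'⟩ : CellPairs h w) = ⟨(i, j), hij, hlt⟩) ↔ (k = i ∧ l = j) := by
      simp
    simp only [hiff]
    have h3 : HasDerivAt (fun s : ℝ => s * if k = i ∧ l = j then (leadDet i b)⁻¹ else 0)
        (if k = i ∧ l = j then (leadDet i b)⁻¹ else 0) 0 := by
      simpa using (hasDerivAt_id (0 : ℝ)).mul_const
        (if k = i ∧ l = j then (leadDet i b)⁻¹ else 0)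
    exact h3.congr_of_eventuallyEq (Eventually.of_forall hval)
  refine ⟨∑ y, (c y * leadDet y.1.1 b) • Z y, fun x => ?_⟩
  have h4 : fderiv ℝ (cellMinor w x.1.1 x.1.2) p (∑ y, (c y * leadDet y.1.1 b) • Z y) =
      ∑ y, (c y * leadDet y.1.1 b) * fderiv ℝ (cellMinor w x.1.1 x.1.2) p (Z y) := by
    refine (map_sum (fderiv ℝ (cellMinor w x.1.1 x.1.2) p)
      (fun y => ((c y * leadDet y.1.1 b) • Z y : Fin n → Fin n → ℝ)) Finset.univ).trans ?_
    exact Finset.sum_congr rfl fun y _ =>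
      (map_smul (fderiv ℝ (cellMinor w x.1.1 x.1.2) p) (c y * leadDet y.1.1 b) (Z y))
  refine h4.trans ?_
  rw [Finset.sum_eq_single x]
  · rw [hdir, if_pos rfl, mul_assoc, mul_inv_cancel₀ (hβ _), mul_one]
  · intro y _ hy
    rw [hdir, if_neg hy, mul_zero]
  · simp

/-- The equations of orthogonality. -/
noncomputable def orthEquation {n : ℕ} (i j : Fin n) (q : Fin n → Fin n → ℝ) : ℝ :=
  ∑ a, q i a * q j a - (1 : Matrix (Fin n) (Fin n) ℝ) i j

theorem mul_transpose_eq_one_iff {n : ℕ} (q : Matrix (Fin n) (Fin n) ℝ) :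
    q * qᵀ = 1 ↔ ∀ i j, i ≤ j → orthEquation i j q = 0 := by
  constructor
  · intro h i j _
    have h1 := congrFun (congrFun h i) j
    rw [Matrix.mul_apply] at h1
    exact sub_eq_zero.2 h1
  · intro h
    have hle : ∀ i j, i ≤ j → ∑ a, q i a * q j a = (1 : Matrix (Fin n) (Fin n) ℝ) i j :=
      fun i j hij => sub_eq_zero.1 (h i j hij)
    ext i j
    rw [Matrix.mul_apply]
    simp only [Matrix.transpose_apply]
    rcases le_total i j with hij | hij
    · exact hle i j hij
    · rw [← Matrix.transpose_one, Matrix.transpose_apply, ← hle j i hij]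
      exact Finset.sum_congr rfl fun a _ => mul_comm _ _

theorem det_eq_one_of_pos {n : ℕ} (q : Matrix (Fin n) (Fin n) ℝ) (hq : q * qᵀ = 1)
    (hpos : 0 < q.det) : q.det = 1 := by
  have h1 := congrArg Matrix.det hq
  rw [Matrix.det_mul, Matrix.det_transpose, Matrix.det_one] at h1
  rcases mul_self_eq_one_iff.1 h1 with h2 | h2
  · exact h2
  · rw [h2] at hpos
    norm_num at hpos

theorem contDiff_orthEquation {n : ℕ} (i j : Fin n) : ContDiff ℝ ∞ (orthEquation i j) := by
  unfold orthEquation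
  refine (ContDiff.sum fun a _ => ?_).sub contDiff_const
  exact (contDiff_apply_apply ℝ ℝ i a).mul (contDiff_apply_apply ℝ ℝ j a)

theorem fderiv_orthEquation_mul {n : ℕ} (i j : Fin n) {p : Matrix (Fin n) (Fin n) ℝ}
    (hp : p * pᵀ = 1) (ξ : Matrix (Fin n) (Fin n) ℝ) :
    fderiv ℝ (orthEquation i j) p (ξ * p : Matrix (Fin n) (Fin n) ℝ) = ξ i j + ξ j i := by
  refine fderiv_eq_of_hasDerivAt (contDiff_orthEquation i j) ?_
  have h1 : HasDerivAt (fun s : ℝ => ∑ a, (p i a + s * (ξ * p) i a) * (p j a + s * (ξ * p) j a) -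
      (1 : Matrix (Fin n) (Fin n) ℝ) i j)
      (∑ a, ((ξ * p) i a * (p j a + 0 * (ξ * p) j a) +
        (p i a + 0 * (ξ * p) i a) * (ξ * p) j a)) 0 := by
    refine HasDerivAt.sub_const _ (HasDerivAt.fun_sum fun a _ => ?_)
    have h2 : ∀ k, HasDerivAt (fun s : ℝ => p k a + s * (ξ * p) k a) ((ξ * p) k a) 0 := by
      intro k
      simpa using ((hasDerivAt_id (0 : ℝ)).mul_const ((ξ * p) k a)).const_add (p k a)
    exact (h2 i).mul (h2 j)
  have h3 : ∀ k l, ∑ a, (ξ * p) k a * p l a = ξ k l := by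
    intro k l
    have : (ξ * p * pᵀ) k l = ξ k l := by rw [mul_assoc, hp, mul_one]
    rw [← this, Matrix.mul_apply]
    rfl
  refine HasDerivAt.congr_deriv h1 ?_
  rw [← h3 i j, ← h3 j i, ← Finset.sum_add_distrib]
  exact Finset.sum_congr rfl fun a _ => by ring

/-- The two opposite cells and the orthogonal group intersect transversally. -/
theorem exists_fderiv_equations_eq {n : ℕ} {lam : Fin n → ℝ} (hinj : Function.Injective lam)
    {v w : Equiv.Perm (Fin n)} {p : Matrix (Fin n) (Fin n) ℝ} (hp : p * pᵀ = 1)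
    (hv : InCell lam v p) (hw : InCell (-lam) w p) (r : Fin n × Fin n → ℝ)
    (cv : CellPairs lam v → ℝ) (cw : CellPairs (-lam) w → ℝ) :
    ∃ z : Matrix (Fin n) (Fin n) ℝ,
      (∀ i j, i ≤ j → fderiv ℝ (orthEquation i j) p z = r (i, j)) ∧
      (∀ x : CellPairs lam v, fderiv ℝ (cellMinor v x.1.1 x.1.2) p z = cv x) ∧
      ∀ x : CellPairs (-lam) w, fderiv ℝ (cellMinor w x.1.1 x.1.2) p z = cw x := by
  have hinj' : Function.Injective (-lam) := neg_injective.comp hinj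
  have hv0 := ((inCell_iff_leadDet hinj v p).1 hv).2
  have hw0 := ((inCell_iff_leadDet hinj' w p).1 hw).2
  obtain ⟨zv, hzv⟩ := exists_fderiv_cellMinor_eq hinj hv cv
  obtain ⟨zw, hzw⟩ := exists_fderiv_cellMinor_eq hinj' hw cw
  -- Opposite triangular parts of `pᵀ * z` in the order of `lam`: `p * Y₁` is tangent to the first
  -- cell and `p * Y₂` to the second. Keeping only the part not tangent to a cell solves its
  -- equations without disturbing the other's.
  have hsplit : ∀ z : Matrix (Fin n) (Fin n) ℝ, ∃ Y₁ Y₂ : Matrix (Fin n) (Fin n) ℝ,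
      z = p * Y₁ + p * Y₂ ∧ (∀ c d, lam c < lam d → Y₁ c d = 0) ∧
      ∀ c d, (-lam) c < (-lam) d → Y₂ c d = 0 := by
    intro z
    refine ⟨Matrix.of fun c d => if lam c < lam d then 0 else (pᵀ * z) c d,
      Matrix.of fun c d => if lam c < lam d then (pᵀ * z) c d else 0, ?_, ?_, ?_⟩
    · rw [← mul_add]
      have : (Matrix.of fun c d => if lam c < lam d then 0 else (pᵀ * z) c d) +
          (Matrix.of fun c d => if lam c < lam d then (pᵀ * z) c d else 0) = pᵀ * z := by
        ext c d
        simp only [Matrix.add_apply, Matrix.of_apply]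
        split_ifs <;> simp
      rw [this, ← mul_assoc, hp, one_mul]
    · intro c d h
      simp [h]
    · intro c d h
      have : ¬ lam c < lam d := (neg_lt_neg_iff.1 h).not_gt
      simp [this]
  have hadd : ∀ (f : (Fin n → Fin n → ℝ) → ℝ) (a b : Matrix (Fin n) (Fin n) ℝ),
      fderiv ℝ f p (a + b) = fderiv ℝ f p a + fderiv ℝ f p b := fun f a b =>
    map_add (fderiv ℝ f p) a b
  obtain ⟨V₁, V₂, hzv', hV₁, hV₂⟩ := hsplit zv
  obtain ⟨W₁, W₂, hzw', hW₁, hW₂⟩ := hsplit zw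
  -- `p * V₂` and `p * W₁` still solve the equations of the cells
  have hvV : ∀ x : CellPairs lam v, fderiv ℝ (cellMinor v x.1.1 x.1.2) p
      (p * V₂ : Matrix (Fin n) (Fin n) ℝ) = cv x := fun x => by
    rw [← hzv x, hzv']
    refine (Eq.trans (hadd _ _ _) ?_).symm
    rw [fderiv_cellMinor_mul x.2.1 x.2.2 hv hV₁, zero_add]
  have hwW : ∀ x : CellPairs (-lam) w, fderiv ℝ (cellMinor w x.1.1 x.1.2) p
      (p * W₁ : Matrix (Fin n) (Fin n) ℝ) = cw x := fun x => by
    rw [← hzw x, hzw']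
    refine (Eq.trans (hadd _ _ _) ?_).symm
    rw [fderiv_cellMinor_mul x.2.1 x.2.2 hw hW₂, add_zero]
  let ρ : Fin n → Fin n → ℝ := fun i j =>
    r (i, j) - fderiv ℝ (orthEquation i j) p (p * V₂ + p * W₁ : Matrix (Fin n) (Fin n) ℝ)
  -- The lower triangular solution of `ξ + ξᵀ = ρ` on the pairs `i ≤ j`, hence the halved diagonal.
  -- The motion `ξ * p` corrects orthogonality and is tangent to both cells.
  let ξ : Matrix (Fin n) (Fin n) ℝ := Matrix.of fun i j =>
    if j < i then ρ j i else if i = j then ρ i i / 2 else 0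
  have hξ : ξ.IsLowerTriangular := by
    intro i j hij
    replace hij : i < j := hij
    simp [ξ, hij.not_gt, hij.ne]
  refine ⟨ξ * p + (p * V₂ + p * W₁), fun i j hij => ?_, fun x => ?_, fun x => ?_⟩
  · refine (hadd _ _ _).trans ?_
    rw [fderiv_orthEquation_mul i j hp]
    rcases hij.lt_or_eq with h | rfl
    · simp [ξ, ρ, h, h.not_gt, h.ne]
    · simp [ξ, ρ]
  · refine (hadd _ _ _).trans ?_
    rw [fderiv_cellMinor_lower_mul (hv0 _ _ x.2.1 x.2.2) hξ, zero_add]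
    refine (hadd _ _ _).trans ?_
    rw [hvV, fderiv_cellMinor_mul x.2.1 x.2.2 hv hW₁, add_zero]
  · refine (hadd _ _ _).trans ?_
    rw [fderiv_cellMinor_lower_mul (hw0 _ _ x.2.1 x.2.2) hξ, zero_add]
    refine (hadd _ _ _).trans ?_
    rw [hwW, fderiv_cellMinor_mul x.2.1 x.2.2 hw hV₂, zero_add]

theorem mem_matrixPreimage_iff {n : ℕ} [NeZero n] {lam : Fin n → ℝ} (hinj : Function.Injective lam)
    {v w : Equiv.Perm (Fin n)} (hvw : v ≠ w) (q : Matrix (Fin n) (Fin n) ℝ) :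
    (q : Fin n → Fin n → ℝ) ∈ matrixPreimage (flowSpace lam (permPoint v) (permPoint w)) ↔
      q * qᵀ = 1 ∧ q.det = 1 ∧ InCell lam v q ∧ InCell (-lam) w q := by
  constructor
  · rintro ⟨g, hg, hgq⟩
    obtain rfl : g.1 = q := by ext i j; exact hgq i j
    obtain ⟨h1, h2, -⟩ := (mem_flowSpace_iff hinj g v w).1 hg
    exact ⟨SO.mul_transpose g, SO.det g, h1, h2⟩
  · rintro ⟨h1, h2, h3, h4⟩
    let g : SO n := ⟨q, Matrix.mem_specialOrthogonalGroup_iff.2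
      ⟨(Matrix.mem_orthogonalGroup_iff _ _).2 h1, h2⟩⟩
    exact ⟨g, (mem_flowSpace_iff hinj g v w).2 ⟨h3, h4, hvw⟩, fun _ _ => rfl⟩

/-- On the open set where the minors of `v` and `w` are nonzero, membership in the cells reduces to
equations; positive determinant singles out `SO_n` among orthogonal matrices. -/
theorem isEmbeddedSubmanifold_flowSpace {n : ℕ} [NeZero n] {lam : Fin n → ℝ}
    (hinj : Function.Injective lam) {v w : Equiv.Perm (Fin n)} (hvw : v ≠ w) {k : ℕ}
    (hk : Fintype.card {x : Fin n × Fin n // x.1 ≤ x.2} + (Fintype.card (CellPairs lam v) +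
      Fintype.card (CellPairs (-lam) w)) + k = n * n) :
    IsEmbeddedSubmanifold k (matrixPreimage (flowSpace lam (permPoint v) (permPoint w))) := by
  have hinj' : Function.Injective (-lam) := neg_injective.comp hinj
  refine isEmbeddedSubmanifold_of_fintype fun p hp => ?_
  obtain ⟨hpp, hdet, hv, hw⟩ := (mem_matrixPreimage_iff hinj hvw p).1 hp
  refine ⟨{q | 0 < (Matrix.of q).det} ∩
      ((⋂ i, {q | leadDet i ((Matrix.of q).submatrix id v) ≠ 0}) ∩
        ⋂ i, {q | leadDet i ((Matrix.of q).submatrix id w) ≠ 0}),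
    {x : Fin n × Fin n // x.1 ≤ x.2} ⊕ (CellPairs lam v ⊕ CellPairs (-lam) w), inferInstance,
    Sum.elim (fun x => orthEquation x.1.1 x.1.2)
      (Sum.elim (fun x => cellMinor v x.1.1 x.1.2) (fun x => cellMinor w x.1.1 x.1.2)),
    ?_, ?_, ?_, ?_, ?_, ?_⟩
  · have hopen : ∀ u : Equiv.Perm (Fin n),
        IsOpen (⋂ i, {q : Fin n → Fin n → ℝ | leadDet i ((Matrix.of q).submatrix id u) ≠ 0}) :=
      fun u => isOpen_iInter_of_finite fun i =>
        isOpen_ne_fun (contDiff_leadDet_submatrix i u).continuous continuous_const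
    refine IsOpen.inter ?_ ((hopen v).inter (hopen w))
    exact isOpen_lt continuous_const (Continuous.matrix_det continuous_id)
  · refine ⟨?_, Set.mem_iInter.2 ((inCell_iff_leadDet hinj v p).1 hv).1,
      Set.mem_iInter.2 ((inCell_iff_leadDet hinj' w p).1 hw).1⟩
    change 0 < Matrix.det p
    rw [hdet]
    exact one_pos
  · rw [Fintype.card_sum, Fintype.card_sum, hk, Module.finrank_pi_fintype]
    simp
  · rintro (x | x | x)
    · exact contDiff_orthEquation _ _
    · exact contDiff_cellMinor _ _ _
    · exact contDiff_cellMinor _ _ _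
  · intro c
    obtain ⟨z, h1, h2, h3⟩ := exists_fderiv_equations_eq hinj hpp hv hw
      (fun x => if h : x.1 ≤ x.2 then c (Sum.inl ⟨x, h⟩) else 0)
      (fun x => c (Sum.inr (Sum.inl x))) (fun x => c (Sum.inr (Sum.inr x)))
    refine ⟨z, ?_⟩
    rintro (x | x | x)
    · exact (h1 _ _ x.2).trans (dif_pos x.2)
    · exact h2 x
    · exact h3 x
  · rintro q ⟨hq0, hqv, hqw⟩
    refine (mem_matrixPreimage_iff hinj hvw q).trans ?_
    have hiv := inCell_iff_leadDet hinj v q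
    have hiw := inCell_iff_leadDet hinj' w q
    constructor
    · rintro ⟨hqq, -, hqv', hqw'⟩
      have hv0 := (hiv.1 hqv').2
      have hw0 := (hiw.1 hqw').2
      rintro (x | x | x)
      · exact (mul_transpose_eq_one_iff q).1 hqq _ _ x.2
      · exact hv0 _ _ x.2.1 x.2.2
      · exact hw0 _ _ x.2.1 x.2.2
    · intro h
      have hqq := (mul_transpose_eq_one_iff q).2 fun i j hij => h (Sum.inl ⟨(i, j), hij⟩)
      refine ⟨hqq, ?_, hiv.2 ⟨Set.mem_iInter.1 hqv, fun i j hij hlt => ?_⟩,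
        hiw.2 ⟨Set.mem_iInter.1 hqw, fun i j hij hlt => ?_⟩⟩
      · exact det_eq_one_of_pos q hqq hq0
      · exact h (Sum.inr (Sum.inl ⟨(i, j), hij, hlt⟩))
      · exact h (Sum.inr (Sum.inr ⟨(i, j), hij, hlt⟩))

/-! ### Row exchanges and points in intersections of cells. -/

theorem InCell.det_ne_zero {n : ℕ} {h : Fin n → ℝ} (hinj : Function.Injective h)
    {w : Equiv.Perm (Fin n)} {g : Matrix (Fin n) (Fin n) ℝ} (hg : InCell h w g) : g.det ≠ 0 := by
  obtain ⟨b, -, -, hup, hone⟩ :=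
    exists_lower_mul_eq_upper _ ((inCell_iff_leadDet hinj w g).1 hg).1
  intro h0
  have h1 : (b * g.submatrix id w).det = 1 := by
    rw [Matrix.det_of_isUpperTriangular fun i j hij => hup i j hij]
    simp [hone]
  rw [Matrix.det_mul, Matrix.det_permute', h0, mul_zero, mul_zero] at h1
  exact zero_ne_one h1

theorem InCell.lower_mul {n : ℕ} {h : Fin n → ℝ} (hinj : Function.Injective h)
    {w : Equiv.Perm (Fin n)} {g : Matrix (Fin n) (Fin n) ℝ} (hg : InCell h w g)
    {b : Matrix (Fin n) (Fin n) ℝ} (hb : b.IsLowerTriangular) (hd : b.det ≠ 0) :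
    InCell h w (b * g) := by
  obtain ⟨h1, h2⟩ := (inCell_iff_leadDet hinj w g).1 hg
  refine (inCell_iff_leadDet hinj w _).2 ⟨fun i => ?_, fun i j hij hlt => ?_⟩
  · rw [submatrix_mul_left, leadDet_mul_of_lower i hb]
    exact mul_ne_zero (leadDet_ne_zero_of_lower i hb hd) (h1 i)
  · rw [submatrix_mul_left, leadDet_mul_of_lower i hb, h2 i j hij hlt, mul_zero]

/-- The matrix `X` with the rows `p`, `q` replaced by `a X_p + X_q`, `X_p`. -/
def exchangeRows {n : ℕ} (p q : Fin n) (a : ℝ) (X : Matrix (Fin n) (Fin n) ℝ) :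
    Matrix (Fin n) (Fin n) ℝ :=
  Matrix.of fun k c => if k = p then a * X p c + X q c else if k = q then X p c else X k c

theorem sum_mul_exchangeRows {n : ℕ} {p q : Fin n} (hpq : p ≠ q) (a : ℝ)
    (X : Matrix (Fin n) (Fin n) ℝ) (r : Fin n → ℝ) (c : Fin n) :
    ∑ j, (if j = p then r q else if j = q then r p - a * r q else r j) *
      exchangeRows p q a X j c = ∑ j, r j * X j c := by
  have hq : q ∈ Finset.univ.erase p := by simp [hpq.symm]
  rw [← Finset.add_sum_erase _ _ (Finset.mem_univ p), ← Finset.add_sum_erase _ _ hq,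
    ← Finset.add_sum_erase _ (fun j => r j * X j c) (Finset.mem_univ p),
    ← Finset.add_sum_erase _ (fun j => r j * X j c) hq]
  have hrest : ∑ j ∈ (Finset.univ.erase p).erase q,
      (if j = p then r q else if j = q then r p - a * r q else r j) * exchangeRows p q a X j c =
      ∑ j ∈ (Finset.univ.erase p).erase q, r j * X j c := by
    refine Finset.sum_congr rfl fun j hj => ?_
    have h1 : j ≠ q := Finset.ne_of_mem_erase hj
    have h2 : j ≠ p := Finset.ne_of_mem_erase (Finset.mem_of_mem_erase hj)
    simp [exchangeRows, h1, h2]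
  rw [hrest]
  simp only [exchangeRows, Matrix.of_apply, if_true, hpq.symm, if_false]
  ring

/-- An exchange of two adjacent rows of `X`, with a suitable parameter, replaces the rows `p`, `q` of
a triangular change `Y = b * X` by `Y_q + γ Y_p` and `γ Y_q + (1 - γ) Y_p`. -/
theorem exists_lower_mul_exchangeRows {n : ℕ} {p q : Fin n} (hpq : p < q)
    (hadj : ∀ k, k < q → k ≤ p) {b : Matrix (Fin n) (Fin n) ℝ} (hb : b.IsLowerTriangular)
    (hd : b.det ≠ 0) (X : Matrix (Fin n) (Fin n) ℝ) {γ : ℝ} (hγ : γ = 0 ∨ γ = 1) :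
    ∃ (a : ℝ) (b' : Matrix (Fin n) (Fin n) ℝ), b'.IsLowerTriangular ∧ b'.det ≠ 0 ∧
      ∀ k c, (b' * exchangeRows p q a X) k c =
        if k = p then (b * X) q c + γ * (b * X) p c
        else if k = q then γ * (b * X) q c + (1 - γ) * (b * X) p c
        else (b * X) k c := by
  have hbd := diag_ne_zero_of_lower hb hd
  set a := (b q p + γ * b p p) / b q q with ha
  -- `s` holds the coefficients of the wanted rows in the rows of `X`, and `b'` the same rows in
  -- terms of `exchangeRows p q a X`.
  let s : Matrix (Fin n) (Fin n) ℝ := Matrix.of fun k j =>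
    if k = p then b q j + γ * b p j else if k = q then γ * b q j + (1 - γ) * b p j else b k j
  let b' : Matrix (Fin n) (Fin n) ℝ := Matrix.of fun k j =>
    if j = p then s k q else if j = q then s k p - a * s k q else s k j
  have hbpq : b p q = 0 := hb hpq
  have haq : a * b q q = b q p + γ * b p p := by rw [ha, div_mul_cancel₀ _ (hbd q)]
  have hlow : b'.IsLowerTriangular := by
    intro k j hkj
    replace hkj : k < j := hkj
    rcases eq_or_ne k p with rfl | hkp
    · rcases eq_or_ne j q with rfl | hjq
      · simp only [b', s, Matrix.of_apply, if_true, hpq.ne', if_false, hbpq, mul_zero, add_zero]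
        rw [haq]; ring
      · have hqj : q < j := by
          rcases lt_trichotomy j q with h | h | h
          · exact absurd (hadj j h) (not_le.2 hkj)
          · exact absurd h hjq
          · exact h
        simp [b', s, hkj.ne', hjq, hb hkj, hb hqj]
    · rcases eq_or_ne k q with rfl | hkq
      · have hpj : p < j := hpq.trans hkj
        simp [b', s, hkp, hkj.ne', hpj.ne', hb hkj, hb hpj]
      · rcases eq_or_ne j p with rfl | hjp
        · simp [b', s, hkj.ne, hkq, hb (hkj.trans hpq)]
        · rcases eq_or_ne j q with rfl | hjq
          · have hkp' : k < p := lt_of_le_of_ne (hadj k hkj) hkp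
            simp [b', s, hkp, hkq, hjp, hb hkj, hb hkp']
          · simp [b', s, hkp, hkq, hjp, hjq, hb hkj]
  have hdiag : ∀ k, b' k k ≠ 0 := by
    intro k
    rcases eq_or_ne k p with rfl | hkp
    · simp [b', s, hbpq, hbd q]
    · rcases eq_or_ne k q with rfl | hkq
      -- This diagonal entry equals `(1 - γ - γ ^ 2) * b p p`, nonzero for both values of `γ`.
      · have : b' k k = (γ * b k p + (1 - γ) * b p p) - γ * (a * b k k) := by
          simp [b', s, hkp, hbpq]; ring
        rw [this, haq]
        rcases hγ with rfl | rfl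
        · simpa using hbd p
        · simpa using hbd p
      · simpa [b', s, hkp, hkq] using hbd k
  refine ⟨a, b', hlow, ?_, fun k c => ?_⟩
  · rw [Matrix.det_of_isLowerTriangular _ hlow]
    exact Finset.prod_ne_zero_iff.2 fun k _ => hdiag k
  · rw [Matrix.mul_apply]
    refine (sum_mul_exchangeRows hpq.ne a X (s k) c).trans ?_
    simp only [Matrix.mul_apply, s, Matrix.of_apply]
    split_ifs
    · rw [Finset.mul_sum, ← Finset.sum_add_distrib]
      exact Finset.sum_congr rfl fun _ _ => by ring
    · rw [Finset.mul_sum, Finset.mul_sum, ← Finset.sum_add_distrib]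
      exact Finset.sum_congr rfl fun _ _ => by ring
    · rfl

/-- The case `γ = 0`: the normalised rows `p` and `q` are simply swapped. -/
theorem InCell.exists_exchangeRows_swap {n : ℕ} {h : Fin n → ℝ} {u : Equiv.Perm (Fin n)}
    {p q : Fin n} (hpq : p < q) (hadj : ∀ k, k < q → k ≤ p) {X : Matrix (Fin n) (Fin n) ℝ}
    (hX : InCell h u X) : ∃ a, InCell h (u * Equiv.swap p q) (exchangeRows p q a X) := by
  obtain ⟨b, hb, hd, hv, hne⟩ := hX
  obtain ⟨a, b', hb', hd', h'⟩ := exists_lower_mul_exchangeRows hpq hadj hb hd X (Or.inl rfl)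
  have h'' : ∀ k c, (b' * exchangeRows p q a X) k c = (b * X) (Equiv.swap p q k) c := by
    intro k c
    rw [h' k c]
    rcases eq_or_ne k p with rfl | hkp
    · simp
    · rcases eq_or_ne k q with rfl | hkq
      · simp [hkp]
      · simp [hkp, hkq, Equiv.swap_apply_of_ne_of_ne]
  refine ⟨a, b', hb', hd', fun k c hc => ?_, fun k => ?_⟩
  · rw [h'']
    exact hv _ _ hc
  · rw [h'']
    exact hne _

/-- The case `γ = 1`: the new rows are `Y_q + Y_p` and `Y_q`, and since the pivot of `Y_p` is
higher, both pivots stay in place. -/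
theorem InCell.exists_exchangeRows {n : ℕ} {h : Fin n → ℝ} {u : Equiv.Perm (Fin n)}
    {p q : Fin n} (hpq : p < q) (hadj : ∀ k, k < q → k ≤ p) (hlt : h (u q) < h (u p))
    {X : Matrix (Fin n) (Fin n) ℝ} (hX : InCell h u X) :
    ∃ a, InCell h u (exchangeRows p q a X) := by
  obtain ⟨b, hb, hd, hv, hne⟩ := hX
  obtain ⟨a, b', hb', hd', h'⟩ := exists_lower_mul_exchangeRows hpq hadj hb hd X (Or.inr rfl)
  refine ⟨a, b', hb', hd', fun k c hc => ?_, fun k => ?_⟩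
  · rw [h' k c]
    split_ifs with h1 h2
    · subst h1
      rw [hv q c (hlt.trans hc), hv k c hc, mul_zero, add_zero]
    · subst h2
      rw [hv k c hc]; simp
    · exact hv k c hc
  · rw [h']
    split_ifs with h1 h2
    · subst h1
      rw [hv q _ hlt, zero_add, one_mul]
      exact hne k
    · subst h2
      simpa using hne k
    · exact hne k

/-- The pivot of `X_q` is higher than that of `X_p`, so `a X_p + X_q` has the pivot of `X_q` for
every `a`. The parameter stays free for the other cell. -/
theorem inCell_exchangeRows_of_vanishAbove {n : ℕ} {h : Fin n → ℝ} {u : Equiv.Perm (Fin n)}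
    {p q : Fin n} (hpq : p ≠ q) (hlt : h (u q) < h (u p)) {X : Matrix (Fin n) (Fin n) ℝ}
    (hX : VanishAbove h (u * Equiv.swap p q) X) (hne : ∀ k, X k ((u * Equiv.swap p q) k) ≠ 0)
    (a : ℝ) : InCell h u (exchangeRows p q a X) := by
  have hXp : ∀ c, h (u q) < h c → X p c = 0 := fun c hc => hX p c (by simpa using hc)
  have hXq : ∀ c, h (u p) < h c → X q c = 0 := fun c hc => hX q c (by simpa using hc)
  have hrest : ∀ k, k ≠ p → k ≠ q → (u * Equiv.swap p q) k = u k := fun k h1 h2 => by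
    simp [Equiv.swap_apply_of_ne_of_ne h1 h2]
  refine ⟨1, Matrix.blockTriangular_one, by simp, ?_, ?_⟩
  · intro k c hc
    rw [one_mul, exchangeRows, Matrix.of_apply]
    split_ifs with h1 h2
    · subst h1
      rw [hXp c (hlt.trans hc), hXq c hc, mul_zero, add_zero]
    · subst h2
      exact hXp c hc
    · exact hX k c (by rwa [hrest k h1 h2])
  · intro k
    rw [one_mul, exchangeRows, Matrix.of_apply]
    split_ifs with h1 h2
    · subst h1
      rw [hXp _ hlt, mul_zero, zero_add]
      simpa using hne q
    · subst h2
      simpa using hne p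
    · simpa [Equiv.swap_apply_of_ne_of_ne h1 h2] using hne k

/-- A nonempty intersection of cells contains a matrix of `SO_n(ℝ)`. -/
theorem exists_SO_inCell {n : ℕ} [NeZero n] {h₁ h₂ : Fin n → ℝ} (hinj₁ : Function.Injective h₁)
    (hinj₂ : Function.Injective h₂) {v w : Equiv.Perm (Fin n)} {X : Matrix (Fin n) (Fin n) ℝ}
    (hv : InCell h₁ v X) (hw : InCell h₂ w X) : ∃ g : SO n, InCell h₁ v g.1 ∧ InCell h₂ w g.1 := by
  have hX := hv.det_ne_zero hinj₁
  obtain ⟨b, hb, hbX⟩ := orthonormalizedRows_eq_lower_mul hX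
  have hQ := orthonormalizedRows_mul_transpose hX
  set Q := orthonormalizedRows X with hQdef
  have hdet : Q.det * Q.det = 1 := by
    have := congrArg Matrix.det hQ
    rwa [Matrix.det_mul, Matrix.det_transpose, Matrix.det_one] at this
  -- The sign of the first row corrects the determinant; a diagonal change of rows is lower
  -- triangular and keeps the cells.
  let D : Matrix (Fin n) (Fin n) ℝ := Matrix.diagonal fun i => if i = 0 then Q.det else 1
  have hDD : D * Dᵀ = 1 := by
    rw [Matrix.diagonal_transpose, Matrix.diagonal_mul_diagonal, ← Matrix.diagonal_one]
    congr 1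
    ext i
    split_ifs
    · exact hdet
    · exact one_mul 1
  have hDdet : D.det = Q.det := by
    rw [Matrix.det_diagonal, Finset.prod_ite_eq' Finset.univ (0 : Fin n)]
    simp
  have hDlow : (D * b).IsLowerTriangular := by
    refine Matrix.BlockTriangular.mul (Matrix.blockTriangular_diagonal _) hb
  have heq : D * Q = D * b * X := by rw [hbX, mul_assoc]
  have hg1 : D * Q * (D * Q)ᵀ = 1 := by
    rw [Matrix.transpose_mul, mul_assoc, ← mul_assoc Q, hQ, one_mul, hDD]
  have hg2 : (D * Q).det = 1 := by rw [Matrix.det_mul, hDdet, hdet]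
  have hDb : (D * b).det ≠ 0 := by
    rw [heq, Matrix.det_mul] at hg2
    exact left_ne_zero_of_mul (by rw [hg2]; exact one_ne_zero)
  refine ⟨⟨D * Q, Matrix.mem_specialOrthogonalGroup_iff.2
    ⟨(Matrix.mem_orthogonalGroup_iff _ _).2 hg1, hg2⟩⟩, ?_, ?_⟩
  · change InCell h₁ v (D * Q)
    rw [heq]
    exact hv.lower_mul hinj₁ hDlow hDb
  · change InCell h₂ w (D * Q)
    rw [heq]
    exact hw.lower_mul hinj₂ hDlow hDb

/-! ### The Bruhat order on `S_4` and non-emptiness. -/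

/-- The tableau criterion for the Bruhat order. -/
def RankDominated {n : ℕ} (v w : Equiv.Perm (Fin n)) : Prop :=
  ∀ i m : Fin n, (Finset.univ.filter fun a => a ≤ i ∧ w a ≤ m).card ≤
    (Finset.univ.filter fun a => a ≤ i ∧ v a ≤ m).card

instance {n : ℕ} (v w : Equiv.Perm (Fin n)) : Decidable (RankDominated v w) :=
  Nat.decidableForallFin _

theorem RankDominated.trans {n : ℕ} {u v w : Equiv.Perm (Fin n)} (h₁ : RankDominated u v)
    (h₂ : RankDominated v w) : RankDominated u w :=
  fun i m => (h₂ i m).trans (h₁ i m)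

/-- In the rows normalised for `v`, the minor on the columns of `w` is nonzero. A nonzero term of it
gives `π` with `v (π a) ≤ w a`, and `π` injects one counted set into the other. -/
theorem rankDominated_of_inCell {n : ℕ} {lam : Fin n → ℝ} {σ : Equiv.Perm (Fin n)}
    (hσ : StrictAnti fun i => lam (σ i)) (hinj : Function.Injective lam)
    {v w : Equiv.Perm (Fin n)} {g : Matrix (Fin n) (Fin n) ℝ}
    (hv : InCell lam (σ * v) g) (hw : InCell (-lam) (σ * w) g) : RankDominated v w := by
  have hinj' : Function.Injective (-lam) := neg_injective.comp hinj
  intro i m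
  obtain ⟨b, hb, hd, hvan, -⟩ := hv
  have hne := ((inCell_iff_leadDet hinj' _ g).1 hw).1 i
  have hne' : leadDet i ((b * g).submatrix id (σ * w : Equiv.Perm (Fin n))) ≠ 0 := by
    rw [submatrix_mul_left, leadDet_mul_of_lower i hb]
    exact mul_ne_zero (leadDet_ne_zero_of_lower i hb hd) hne
  obtain ⟨π, hπ⟩ := exists_perm_of_leadDet_ne_zero hvan _ i hne'
  have hle : ∀ a : {a // a ≤ i}, v (π a) ≤ w a := fun a => hσ.le_iff_ge.1 (hπ a)
  refine Finset.card_le_card_of_injOn (fun a => if ha : a ≤ i then (π ⟨a, ha⟩ : Fin n) else a) ?_ ?_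
  · intro a ha
    obtain ⟨h1, h2⟩ : a ≤ i ∧ w a ≤ m := by simpa using ha
    simp only [dif_pos h1, Finset.coe_filter, Finset.mem_univ, true_and]
    exact ⟨(π ⟨a, h1⟩).2, (hle ⟨a, h1⟩).trans h2⟩
  · intro a ha c hc hac
    obtain ⟨h1, -⟩ : a ≤ i ∧ w a ≤ m := by simpa using ha
    obtain ⟨h2, -⟩ : c ≤ i ∧ w c ≤ m := by simpa using hc
    simp only [dif_pos h1, dif_pos h2] at hac
    exact congrArg Subtype.val (π.injective (Subtype.ext hac))

/-- A finite check: below `w` one can climb by one step and remain below `w`. Iterated, this turns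
the rank inequalities into a Bruhat chain. -/
theorem exists_bruhatStep_of_rankDominated : ∀ v w : Equiv.Perm (Fin 4), RankDominated v w →
    v = w ∨ ∃ i j : Fin 4, i ≠ j ∧ permLength (Equiv.swap i j * v) = permLength v + 1 ∧
      RankDominated (Equiv.swap i j * v) w := by
  decide +kernel

theorem rankDominated_swap_mul : ∀ (v : Equiv.Perm (Fin 4)) (i j : Fin 4),
    permLength (Equiv.swap i j * v) = permLength v + 1 → RankDominated v (Equiv.swap i j * v) := by
  decide +kernel

/-- The lifting property of the Bruhat order. -/
theorem rankDominated_lifting : ∀ v w : Equiv.Perm (Fin 4), RankDominated v w →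
    (v = 1 ∧ w = 1) ∨ ∃ i : Fin 3, w i.succ < w i.castSucc ∧
      permLength (w * Equiv.swap i.castSucc i.succ) < permLength w ∧
      if v i.succ < v i.castSucc then
        RankDominated (v * Equiv.swap i.castSucc i.succ) (w * Equiv.swap i.castSucc i.succ)
      else RankDominated v (w * Equiv.swap i.castSucc i.succ) := by
  decide +kernel

theorem BruhatLT.rankDominated {v w : Equiv.Perm (Fin 4)} (h : BruhatLT v w) :
    RankDominated v w := by
  have hstep : ∀ {x y : Equiv.Perm (Fin 4)}, BruhatStep x y → RankDominated x y := by
    rintro x y ⟨⟨i, j, -, rfl⟩, hl⟩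
    exact rankDominated_swap_mul x i j hl
  induction h with
  | single h => exact hstep h
  | tail _ h ih => exact ih.trans (hstep h)

theorem BruhatLT.permLength_lt {n : ℕ} {v w : Equiv.Perm (Fin n)} (h : BruhatLT v w) :
    permLength v < permLength w := by
  induction h with
  | single h => rw [h.2]; exact Nat.lt_succ_self _
  | tail _ h ih => rw [h.2]; exact Nat.lt_succ_of_lt ih

theorem bruhatLT_of_rankDominated {v w : Equiv.Perm (Fin 4)} (h : RankDominated v w)
    (hne : v ≠ w) : BruhatLT v w := by
  -- The crude bound by the number of all pairs; it only makes the climb terminate.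
  have hbound : ∀ u : Equiv.Perm (Fin 4), permLength u ≤ 16 := fun u => Finset.card_le_univ _
  have key : ∀ k : ℕ, ∀ v : Equiv.Perm (Fin 4), 16 ≤ permLength v + k → RankDominated v w →
      v = w ∨ BruhatLT v w := by
    intro k
    induction k with
    | zero =>
      intro v hk hv
      rcases exists_bruhatStep_of_rankDominated v w hv with he | ⟨i, j, -, hl, -⟩
      · exact Or.inl he
      · have := hbound (Equiv.swap i j * v)
        omega
    | succ k ih =>
      intro v hk hv
      rcases exists_bruhatStep_of_rankDominated v w hv with he | ⟨i, j, hij, hl, hd⟩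
      · exact Or.inl he
      · have hs : BruhatStep v (Equiv.swap i j * v) := ⟨⟨i, j, hij, rfl⟩, hl⟩
        rcases ih _ (by omega) hd with he | hlt
        · exact Or.inr (.single (he ▸ hs))
        · exact Or.inr (.head hs hlt)
  exact (key 16 v (by omega) h).resolve_left hne

/-- The intersection of opposite cells is nonempty if the permutations are comparable. -/
theorem exists_inCell_of_rankDominated {lam : Fin 4 → ℝ} {σ : Equiv.Perm (Fin 4)}
    (hσ : StrictAnti fun i => lam (σ i)) (hinj : Function.Injective lam)
    (v w : Equiv.Perm (Fin 4)) (h : RankDominated v w) :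
    ∃ X : Matrix (Fin 4) (Fin 4) ℝ, InCell lam (σ * v) X ∧ InCell (-lam) (σ * w) X := by
  induction hk : permLength w using Nat.strong_induction_on generalizing v w with
  | _ k ih =>
  rcases rankDominated_lifting v w h with ⟨rfl, rfl⟩ | ⟨i, hw, hlen, hv⟩
  · refine ⟨Matrix.of fun k c => if σ k = c then 1 else 0, ?_⟩
    have hcell : ∀ h : Fin 4 → ℝ,
        InCell h (σ * 1) (Matrix.of fun k c => if σ k = c then (1 : ℝ) else 0) := by
      intro h
      refine ⟨1, Matrix.blockTriangular_one, by simp, fun k c hc => ?_, fun k => ?_⟩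
      · rw [one_mul, Matrix.of_apply, if_neg]
        rintro rfl
        exact lt_irrefl _ hc
      · simp
    exact ⟨hcell _, hcell _⟩
  · set p := i.castSucc with hp
    set q := i.succ with hq
    have hpq : p < q := Fin.castSucc_lt_succ
    have hadj : ∀ k, k < q → k ≤ p := fun k hk => Fin.le_castSucc_iff.2 hk
    have hinj' : Function.Injective (-lam) := neg_injective.comp hinj
    -- With rows normalised for the shorter `w * swap p q`, every `a` leads into the cell of `w`;
    -- `a` is then fixed by the cell of `v`, according to whether `v` descends at `p`.
    have hexch : ∀ v', RankDominated v' (w * Equiv.swap p q) → ∃ X : Matrix (Fin 4) (Fin 4) ℝ,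
        InCell lam (σ * v') X ∧ ∀ a, InCell (-lam) (σ * w) (exchangeRows p q a X) := by
      intro v' hv'
      obtain ⟨g, hg1, b, hb, hd, hvan, hne⟩ := ih _ (hk ▸ hlen) v' (w * Equiv.swap p q) hv' rfl
      refine ⟨b * g, hg1.lower_mul hinj hb hd, fun a => ?_⟩
      rw [← mul_assoc] at hvan hne
      exact inCell_exchangeRows_of_vanishAbove hpq.ne (neg_lt_neg (hσ hw)) hvan hne a
    split_ifs at hv with hvi
    · obtain ⟨X, hX1, hX2⟩ := hexch _ hv
      obtain ⟨a, ha⟩ := hX1.exists_exchangeRows_swap hpq hadj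
      refine ⟨_, ?_, hX2 a⟩
      rwa [mul_assoc, mul_assoc, Equiv.swap_mul_self, mul_one] at ha
    · obtain ⟨X, hX1, hX2⟩ := hexch _ hv
      have hlt : v p < v q := lt_of_le_of_ne (not_lt.1 hvi) fun he => hpq.ne (v.injective he)
      obtain ⟨a, ha⟩ := hX1.exists_exchangeRows (u := σ * v) hpq hadj (hσ hlt)
      exact ⟨_, ha, hX2 a⟩

theorem flowSpace_nonempty_iff {lam : Fin 4 → ℝ} {σ : Equiv.Perm (Fin 4)}
    (hσ : StrictAnti fun i => lam (σ i)) (hinj : Function.Injective lam)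
    (v w : Equiv.Perm (Fin 4)) :
    (flowSpace lam (permPoint (σ * v)) (permPoint (σ * w))).Nonempty ↔ BruhatLT v w := by
  constructor
  · rintro ⟨p, hp⟩
    obtain ⟨g, rfl⟩ := QuotientGroup.mk_surjective p
    obtain ⟨h1, h2, h3⟩ := (mem_flowSpace_iff hinj g _ _).1 hp
    exact bruhatLT_of_rankDominated (rankDominated_of_inCell hσ hinj h1 h2)
      fun h => h3 (congrArg (σ * ·) h)
  · intro h
    obtain ⟨X, h1, h2⟩ := exists_inCell_of_rankDominated hσ hinj v w h.rankDominated
    obtain ⟨g, hg1, hg2⟩ := exists_SO_inCell hinj (neg_injective.comp hinj :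
      Function.Injective (-lam)) h1 h2
    refine ⟨g, (mem_flowSpace_iff hinj g _ _).2 ⟨hg1, hg2, fun he => ?_⟩⟩
    have hvw : v = w := mul_left_cancel he
    exact (hvw ▸ h.permLength_lt).ne rfl

/-! ### Dimension counts and lengths of Bruhat segments. -/

theorem card_cellPairs_lower {n : ℕ} {lam : Fin n → ℝ} {σ : Equiv.Perm (Fin n)}
    (hσ : StrictAnti fun i => lam (σ i)) (v : Equiv.Perm (Fin n)) :
    Fintype.card (CellPairs lam (σ * v)) = permLength v := by
  rw [Fintype.card_subtype]
  refine congrArg Finset.card (Finset.filter_congr fun x _ => and_congr_right fun _ => ?_)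
  exact hσ.lt_iff_gt

/-- For the opposite height the equations are indexed by the non-inversions of `w`. -/
theorem card_cellPairs_upper {n : ℕ} {lam : Fin n → ℝ} {σ : Equiv.Perm (Fin n)}
    (hσ : StrictAnti fun i => lam (σ i)) (w : Equiv.Perm (Fin n)) :
    Fintype.card (CellPairs (-lam) (σ * w)) + permLength w =
      (Finset.univ.filter fun x : Fin n × Fin n => x.1 < x.2).card := by
  rw [Fintype.card_subtype, permLength, ← Finset.card_union_of_disjoint]
  · congr 1
    ext x
    simp only [Finset.mem_union, Finset.mem_filter, Finset.mem_univ, true_and, ← and_or_left]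
    refine and_iff_left_of_imp fun hx => ?_
    rcases lt_or_gt_of_ne (fun he => hx.ne (w.injective he) : w x.1 ≠ w x.2) with h | h
    · exact Or.inl (neg_lt_neg (hσ h))
    · exact Or.inr h
  · refine Finset.disjoint_filter.2 fun x _ h1 h2 => ?_
    exact lt_asymm h1.2 (neg_lt_neg (hσ h2.2))

theorem isFlowOfDim_iff {lam : Fin 4 → ℝ} {σ : Equiv.Perm (Fin 4)}
    (hσ : StrictAnti fun i => lam (σ i)) (hinj : Function.Injective lam) (k : ℕ)
    (v w : Equiv.Perm (Fin 4)) :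
    IsFlowOfDim lam k (permPoint (σ * v)) (permPoint (σ * w)) ↔
      BruhatLT v w ∧ permLength w = permLength v + k := by
  rw [IsFlowOfDim, flowSpace_nonempty_iff hσ hinj]
  refine and_congr_right fun h => ?_
  have hlt := h.permLength_lt
  have hne : σ * v ≠ σ * w := fun he => (mul_left_cancel he ▸ hlt).ne rfl
  -- In the 16-dimensional matrix space there are 10 equations of orthogonality, `permLength v` for
  -- one cell and `6 - permLength w` for the other.
  have hsub : IsEmbeddedSubmanifold (permLength w - permLength v)
      (matrixPreimage (flowSpace lam (permPoint (σ * v)) (permPoint (σ * w)))) := by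
    refine isEmbeddedSubmanifold_flowSpace hinj hne ?_
    have h1 := card_cellPairs_lower hσ v
    have h2 := card_cellPairs_upper hσ w
    have h3 : Fintype.card {x : Fin 4 × Fin 4 // x.1 ≤ x.2} = 10 := by decide
    have h4 : (Finset.univ.filter fun x : Fin 4 × Fin 4 => x.1 < x.2).card = 6 := by decide
    omega
  constructor
  · intro hk
    obtain ⟨p, hp⟩ := (flowSpace_nonempty_iff hσ hinj v w).2 h
    obtain ⟨g, rfl⟩ := QuotientGroup.mk_surjective p
    have hne : (matrixPreimage
        (flowSpace lam (permPoint (σ * v)) (permPoint (σ * w)))).Nonempty :=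
      ⟨fun i j => g.1 i j, g, hp, fun _ _ => rfl⟩
    have := hk.dim_unique hne hsub
    omega
  · intro hk
    rwa [show k = permLength w - permLength v by omega]

theorem BruhatLT.trans {n : ℕ} {u v w : Equiv.Perm (Fin n)} (h₁ : BruhatLT u v)
    (h₂ : BruhatLT v w) : BruhatLT u w := Relation.TransGen.trans h₁ h₂

theorem permLength_add_le_of_chain {n m : ℕ} (c : Fin (m + 1) → Equiv.Perm (Fin n))
    (hc : ∀ i : Fin m, BruhatLT (c i.castSucc) (c i.succ)) (j : Fin (m + 1)) :
    permLength (c 0) + j ≤ permLength (c j) := by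
  induction j using Fin.induction with
  | zero => simp
  | succ i ih =>
    have := (hc i).permLength_lt
    rw [Fin.val_castSucc] at ih
    rw [Fin.val_succ]
    omega

theorem bruhatLT_of_chain {n m : ℕ} (c : Fin (m + 1) → Equiv.Perm (Fin n))
    (hc : ∀ i : Fin m, BruhatLT (c i.castSucc) (c i.succ)) (j : Fin (m + 1)) (hj : 0 < j) :
    BruhatLT (c 0) (c j) := by
  induction j using Fin.induction with
  | zero => exact absurd hj (lt_irrefl _)
  | succ i ih =>
    rcases eq_or_ne i.castSucc 0 with h0 | h0
    · have := hc i
      rwa [h0] at this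
    · exact (ih (Fin.pos_iff_ne_zero.2 h0)).trans (hc i)

theorem BruhatLT.exists_chain {n : ℕ} {v w : Equiv.Perm (Fin n)} (h : BruhatLT v w) :
    ∃ m, permLength w = permLength v + m ∧ ∃ c : Fin (m + 1) → Equiv.Perm (Fin n),
      c 0 = v ∧ c (Fin.last m) = w ∧ ∀ i : Fin m, BruhatLT (c i.castSucc) (c i.succ) := by
  induction h with
  | single h =>
    rename_i w
    refine ⟨1, h.2, ![v, w], rfl, rfl, fun i => ?_⟩
    rw [Subsingleton.elim i 0]
    exact .single h
  | tail _ h ih =>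
    rename_i u w _
    obtain ⟨m, hm, c, h0, hlast, hc⟩ := ih
    refine ⟨m + 1, by rw [h.2, hm, add_assoc], Fin.snoc c w, ?_, Fin.snoc_last .., fun i => ?_⟩
    · rw [← h0]
      exact Fin.snoc_castSucc (α := fun _ => Equiv.Perm (Fin n)) w c 0
    · rw [Fin.snoc_castSucc (α := fun _ => Equiv.Perm (Fin n)) w c i]
      induction i using Fin.lastCases with
      | last =>
        rw [Fin.succ_last, Fin.snoc_last, hlast]
        exact .single h
      | cast i =>
        rw [Fin.succ_castSucc, Fin.snoc_castSucc (α := fun _ => Equiv.Perm (Fin n)) w c i.succ]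
        exact hc i

/-- Every Bruhat relation raises the length by at least one, and a chain of generating steps raises
it by exactly one each time, so the longest chains have the difference of lengths. The bound on `k`
excludes the trivial chain with `v = w`. -/
theorem segmentHasLength_iff {n : ℕ} {v w : Equiv.Perm (Fin n)} {k : ℕ} (hk : 1 ≤ k) :
    SegmentHasLength v w k ↔ BruhatLT v w ∧ permLength w = permLength v + k := by
  have hle : ∀ m, (∃ c : Fin (m + 1) → Equiv.Perm (Fin n), c 0 = v ∧ c (Fin.last m) = w ∧
      ∀ i : Fin m, BruhatLT (c i.castSucc) (c i.succ)) → permLength v + m ≤ permLength w := by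
    rintro m ⟨c, rfl, rfl, hc⟩
    simpa using permLength_add_le_of_chain c hc (Fin.last m)
  constructor
  · rintro ⟨⟨c, h0, hlast, hc⟩, hmax⟩
    have hlt : BruhatLT v w := by
      have := bruhatLT_of_chain c hc (Fin.last k) (Fin.lt_def.2 (Nat.lt_of_succ_le hk))
      rwa [h0, hlast] at this
    refine ⟨hlt, ?_⟩
    obtain ⟨m, hm, hchain⟩ := hlt.exists_chain
    have h1 := hmax hchain
    have h2 := hle k ⟨c, h0, hlast, hc⟩
    omega
  · rintro ⟨hlt, hl⟩
    obtain ⟨m, hm, hchain⟩ := hlt.exists_chain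
    obtain rfl : m = k := by omega
    refine ⟨hchain, fun m' hm' => ?_⟩
    have := hle m' hm'
    omega

end Toda

theorem mainTheorem3 (lam : Fin 4 → ℝ) (σ : Equiv.Perm (Fin 4))
    (hσ : StrictAnti (fun i => lam (σ i))) :
    Set.BijOn (Toda.permPoint (n := 4)) Set.univ {p | Toda.IsSingularPoint lam p} ∧
    (∀ v w : Equiv.Perm (Fin 4),
      (∃ γ : ℝ → Toda.Flag 4,
        Toda.IsConnecting lam (Toda.permPoint (σ * v)) (Toda.permPoint (σ * w)) γ) ↔
      Toda.BruhatLT v w) ∧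
    (∀ (k : ℕ), 1 ≤ k → ∀ v w : Equiv.Perm (Fin 4),
      Toda.IsFlowOfDim lam k (Toda.permPoint (σ * v)) (Toda.permPoint (σ * w)) ↔
      Toda.SegmentHasLength v w k) := by
  have hinj : Function.Injective lam := by
    intro a b hab
    obtain ⟨i, rfl⟩ := σ.surjective a
    obtain ⟨j, rfl⟩ := σ.surjective b
    rw [hσ.injective hab]
  refine ⟨Toda.bijOn_permPoint hinj, fun v w => ?_, fun k hk v w => ?_⟩
  · rw [Toda.exists_isConnecting_iff, Toda.flowSpace_nonempty_iff hσ hinj]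
  · rw [Toda.isFlowOfDim_iff hσ hinj, Toda.segmentHasLength_iff hk]
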